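/- Let $K$ be a commutative artinian ring and let $A$ be a basic connected artin algebra over $K$, that is, a $K$-algebra which is finitely generated as a $K$-module, such that the quotient of $A$ by its Jacobson radical is a finite product of division rings, and such that $A$ is non-zero and its only central idempotents are $0$ and $1$. Let $\operatorname{mod} A$ be the category of finitely generated right $A$-modules, and let $\Gamma_A$ be the Auslander-Reiten quiver of $A$: its vertices are the isomorphism classes of indecomposable modules in $\operatorname{mod} A$, and there is an arrow from $X$ to $Y$ if and only if there is an irreducible homomorphism $X \to Y$ in $\operatorname{mod} A$. Let $\mathcal{C}$ be a connected component of $\Gamma_A$ such that - $\mathcal{C}$ is semi-regular, that is, $\mathcal{C}$ does not contain both a projective module and an injective module; and - $\mathcal{C}$ has no external short path, that is, there is no sequence $X \to Y \to Z$ of non-zero non-isomorphisms between indecomposable modules in $\operatorname{mod} A$ with $X$ and $Z$ in $\mathcal{C}$ but $Y$ not in $\mathcal{C}$. Let $\operatorname{ann}_A(\mathcal{C}) = \{a \in A \mid Xa = 0 \text{ for all } X \text{ in } \mathcal{C}\}$, a two-sided ideal of $A$. Then $B = A/\operatorname{ann}_A(\mathcal{C})$ is a quasi-tilted algebra; that is,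 $B$ is a basic connected artin algebra over $K$, every right $B$-module has projective dimension at most $2$ (so $B$ has global dimension at most $2$), and every indecomposable finitely generated right $B$-module has projective dimension at most $1$ or injective dimension at most $1$. -/

import Mathlib

open CategoryTheory

universe u

/-! Right modules over a ring `A` are modules over the opposite ring `Aᵐᵒᵖ`
(`MulOpposite.op a • x` is the product `x a`). The notions below about modules are stated for
left modules over an arbitrary ring `R` and are used for `R = Aᵐᵒᵖ`. -/

/-- A ring is basic if its quotient by the Jacobson radical is a finite product of division rings.
For an artinian ring this says that the regular module is a direct sum of pairwise non-isomorphic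
indecomposable modules. -/
def IsBasicRing (A : Type u) [Ring A] : Prop :=
  ∃ (n : ℕ) (D : Fin n → Type u) (_ : ∀ i, DivisionRing (D i)),
    Nonempty ((A ⧸ Ring.jacobson A) ≃+* ((i : Fin n) → D i))

/-- A ring is connected (indecomposable as a ring) if it is non-zero and `0`, `1` are its only
central idempotents. -/
def IsConnectedRing (A : Type u) [Ring A] : Prop :=
  Nontrivial A ∧ ∀ e : A, IsIdempotentElem e → (∀ a : A, e * a = a * e) → e = 0 ∨ e = 1

/-- `A` is a basic connected artin algebra over the commutative artinian ring `K`. -/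
structure IsBasicConnectedArtinAlgebra (K A : Type u) [CommRing K] [Ring A] [Algebra K A] :
    Prop where
  isArtinianRing : IsArtinianRing K
  finite : Module.Finite K A
  basic : IsBasicRing A
  connected : IsConnectedRing A

section Modules

variable {R : Type u} [Ring R]

/-- Finitely generated indecomposable modules. -/
def IsFGIndecomposable (X : ModuleCat.{u} R) : Prop :=
  Module.Finite R X ∧ Indecomposable X

/-- Irreducible homomorphisms in the category of finitely generated modules: `f` is neither a split
monomorphism nor a split epimorphism, and in every factorization of `f` through a finitely generated
module the first factor is a split monomorphism or the second one is a split epimorphism. -/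
def IsIrreducibleHom {X Y : ModuleCat.{u} R} (f : X ⟶ Y) : Prop :=
  ¬ IsSplitMono f ∧ ¬ IsSplitEpi f ∧
    ∀ (Z : ModuleCat.{u} R), Module.Finite R Z → ∀ (g : X ⟶ Z) (h : Z ⟶ Y), g ≫ h = f →
      IsSplitMono g ∨ IsSplitEpi h

/-- `X` and `Y` are finitely generated indecomposable modules which define the same vertex of the
Auslander-Reiten quiver, or there is an arrow from `X` to `Y` in this quiver. -/
def ARStep (X Y : ModuleCat.{u} R) : Prop :=
  IsFGIndecomposable X ∧ IsFGIndecomposable Y ∧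
    (Nonempty (X ≅ Y) ∨ ∃ f : X ⟶ Y, IsIrreducibleHom f)

/-- `C` is (the class of all modules whose isomorphism class is a vertex of) a connected component
of the Auslander-Reiten quiver. -/
def IsARComponent (C : Set (ModuleCat.{u} R)) : Prop :=
  ∃ X : ModuleCat.{u} R, IsFGIndecomposable X ∧ C = {Y | Relation.EqvGen ARStep X Y}

/-- `C` does not contain both a projective module and an injective module. -/
def IsSemiRegular (C : Set (ModuleCat.{u} R)) : Prop :=
  ¬ ((∃ P ∈ C, Module.Projective R P) ∧ (∃ I ∈ C, Module.Injective R I))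

/-- `C` has an external short path: a sequence `X ⟶ Y ⟶ Z` of non-zero non-isomorphisms between
finitely generated indecomposable modules with `X` and `Z` in `C` and `Y` not in `C`. -/
def HasExternalShortPath (C : Set (ModuleCat.{u} R)) : Prop :=
  ∃ (X Y Z : ModuleCat.{u} R) (f : X ⟶ Y) (g : Y ⟶ Z),
    IsFGIndecomposable X ∧ IsFGIndecomposable Y ∧ IsFGIndecomposable Z ∧
    X ∈ C ∧ Y ∉ C ∧ Z ∈ C ∧ f ≠ 0 ∧ ¬ IsIso f ∧ g ≠ 0 ∧ ¬ IsIso g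

end Modules

/-- The annihilator `{a | X a = 0 for all X in C}` of a class `C` of right `A`-modules. -/
def annihilatorOf {A : Type u} [Ring A] (C : Set (ModuleCat.{u} Aᵐᵒᵖ)) : Ideal A where
  carrier := {a | ∀ X ∈ C, ∀ x : X, MulOpposite.op a • x = 0}
  add_mem' := by
    intro a b ha hb X hX x
    rw [MulOpposite.op_add, add_smul, ha X hX x, hb X hX x, add_zero]
  zero_mem' := by
    intro X _ x
    rw [MulOpposite.op_zero, zero_smul]
  smul_mem' := by
    intro b a ha X hX x
    rw [smul_eq_mul, MulOpposite.op_mul, mul_smul]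
    exact ha X hX _

instance annihilatorOf_isTwoSided {A : Type u} [Ring A] (C : Set (ModuleCat.{u} Aᵐᵒᵖ)) :
    (annihilatorOf C).IsTwoSided where
  mul_mem_of_left := by
    intro a b ha X hX x
    rw [MulOpposite.op_mul, mul_smul, ha X hX x, smul_zero]

/-- `B` is a quasi-tilted algebra over `K`: a basic connected artin algebra of (right) global
dimension at most two such that every indecomposable finitely generated right `B`-module has
projective dimension at most one or injective dimension at most one. -/
structure IsQuasiTilted (K B : Type u) [CommRing K] [Ring B] [Algebra K B] : Prop where
  isBasicConnectedArtinAlgebra : IsBasicConnectedArtinAlgebra K B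
  globalDimension_le_two : ∀ M : ModuleCat.{u} Bᵐᵒᵖ, HasProjectiveDimensionLE M 2
  projectiveDimension_or_injectiveDimension_le_one :
    ∀ M : ModuleCat.{u} Bᵐᵒᵖ, IsFGIndecomposable M →
      HasProjectiveDimensionLE M 1 ∨ HasInjectiveDimensionLE M 1

/-!
The proof works inside the category of finitely generated `B`-modules, `B = A/ann(C)`, where `C`
acts faithfully. By semi-regularity `C` contains no injective or no projective module; the second
case is the first one in the opposite category, so suppose that `C` contains no injectives.

Faithfulness says that every projective `B`-module `Q` embeds in a finite direct sum of modules
of `C`, and it follows that every injective `B`-module is a quotient of such a sum. Since `C` is a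
component, the middle term of the almost split map ending at a module of `C` is again a direct sum
of modules of `C`. These facts and the absence of external short paths `X ⟶ Y ⟶ Z` (with `X`, `Z`
in `C` and `Y` outside) are collected in `IsPathClosedFaithfulClass`, and all bounds on dimensions
are derived from them in an abelian category.

* An indecomposable `N` with a non-zero map `g : N ⟶ Z`, `Z` in `C`, has projective dimension at
  most one (`IsPathClosedFaithfulClass.hasProjectiveDimensionLT_two`). If not, a non-split extension of
  `N` by a quotient of an injective module `J` factors through the minimal right almost split map
  `π : E ⟶ N` and gives a non-zero map `J ⟶ E` killed by `π`; as `J` is generated by `C`, some `X`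
  in `C` maps non-trivially to `E` and is killed by `π`. For `N` in `C`, the path
  `X ⟶ J' ⟶ Y` through an indecomposable summand `J'` of `J` and a summand `Y` of `E` is an external
  short path. For `N` outside `C` there are no non-zero maps from `C` to `N`, the summands of `E`
  hit by `C` compose to zero with `g`, so that they map into a proper submodule of `N`, and right
  minimality of `π` is violated.
* Submodules of projectives are submodules of sums of modules in `C`, so they have projective
  dimension at most one, and every finitely generated module has projective dimension at most two.
* If an indecomposable `Z` has injective dimension at least two, there is a non-split extension `Y`
  of a submodule `U` of a projective module by `Z`. Every indecomposable summand of `Y` maps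
  non-trivially to `U`, hence to `C`, so `Y` and `U` have projective dimension at most one, and so
  does `Z` (`IsPathClosedFaithfulClass.hasProjectiveDimensionLT_two_or`).

Modules of `C` remain non-injective over `B`: their left almost split maps are injective, non-split
and have targets in the additive closure of `C`, which consists of `B`-modules
(`not_injective_of_restrictedClass`).

The existence of almost split maps over an artin algebra is obtained from Matlis duality: the
commutative artinian ring `K` has a finitely generated injective cogenerator `E`, and for an
indecomposable `N` an `E`-valued functional on `End N` which vanishes at the non-isomorphisms but
not at the identity produces the almost split maps (`IsDualizingModule.exists_rightAlmostSplit`,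
`IsDualizingModule.exists_leftAlmostSplit`). Minimality comes from a choice of least length.

The bounds for finitely generated modules pass to all modules by dimension shifting and Baer's
criterion. A quotient of a basic ring is basic, since a quotient of a finite product of division
rings is the product of some of the factors. A central idempotent of `B` acts on each module of `C`
as zero or one, the same value along irreducible maps because these are non-zero, so that `B` is
connected by faithfulness.
-/

/-! ### Finite direct sums in additive categories -/

section FiniteSums

open Limits

/-- `E` is a finite direct sum of objects satisfying `C`. The direct sum is recorded by its
injections and projections, which makes the notion visibly self-dual. -/
def IsFiniteSum {𝒜 : Type*} [Category 𝒜] [Preadditive 𝒜] (C : 𝒜 → Prop) (E : 𝒜) : Prop :=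
  ∃ (ι : Type) (_ : Fintype ι) (Y : ι → 𝒜) (i : ∀ j, Y j ⟶ E) (p : ∀ j, E ⟶ Y j),
    (∀ j, C (Y j)) ∧ (∀ j, i j ≫ p j = 𝟙 _) ∧ (∀ j k, j ≠ k → i j ≫ p k = 0) ∧
      ∑ j, p j ≫ i j = 𝟙 E

/-- `X` is non-zero and its only idempotent endomorphisms are `0` and `𝟙 X`. In an abelian
category this is indecomposability. -/
def IsIdempotentFree {𝒜 : Type*} [Category 𝒜] [Preadditive 𝒜] (X : 𝒜) : Prop :=
  ¬ IsZero X ∧ ∀ e : X ⟶ X, e ≫ e = e → e = 0 ∨ e = 𝟙 X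

variable {𝒜 : Type*} [Category 𝒜] [Preadditive 𝒜]

lemma IsFiniteSum.op {C : 𝒜 → Prop} {E : 𝒜} (h : IsFiniteSum C E) :
    IsFiniteSum (fun X : 𝒜ᵒᵖ => C X.unop) (Opposite.op E) := by
  obtain ⟨ι, _, Y, i, p, hY, h1, h0, hs⟩ := h
  refine ⟨ι, inferInstance, fun j => .op (Y j), fun j => (p j).op, fun j => (i j).op, hY,
    fun j => ?_, fun j k hjk => ?_, ?_⟩
  · rw [← op_comp, h1, op_id]
  · rw [← op_comp, h0 k j hjk.symm, op_zero]
  · rw [← op_id, ← hs, op_sum]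
    simp

lemma IsFiniteSum.mono {C D : 𝒜 → Prop} {E : 𝒜} (h : IsFiniteSum C E) (hCD : ∀ X, C X → D X) :
    IsFiniteSum D E := by
  obtain ⟨ι, _, Y, i, p, hY, h⟩ := h
  exact ⟨ι, inferInstance, Y, i, p, fun j => hCD _ (hY j), h⟩

lemma IsFiniteSum.exists_from_ne_zero {C : 𝒜 → Prop} {E X : 𝒜} (h : IsFiniteSum C E)
    {f : E ⟶ X} (hf : f ≠ 0) : ∃ (Y : 𝒜) (r : Retract Y E), C Y ∧ r.i ≫ f ≠ 0 := by
  obtain ⟨ι, _, Y, i, p, hY, h1, h0, hs⟩ := h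
  by_contra! H
  apply hf
  rw [← Category.id_comp f, ← hs, Preadditive.sum_comp]
  exact Finset.sum_eq_zero fun j _ => by
    rw [Category.assoc, H _ ⟨i j, p j, h1 j⟩ (hY j), comp_zero]

lemma IsFiniteSum.exists_to_ne_zero {C : 𝒜 → Prop} {E X : 𝒜} (h : IsFiniteSum C E)
    {f : X ⟶ E} (hf : f ≠ 0) : ∃ (Y : 𝒜) (p : E ⟶ Y), C Y ∧ f ≫ p ≠ 0 := by
  obtain ⟨ι, _, Y, i, p, hY, h1, h0, hs⟩ := h
  by_contra! H
  apply hf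
  rw [← Category.comp_id f, ← hs, Preadditive.comp_sum]
  exact Finset.sum_eq_zero fun j _ => by rw [← Category.assoc, H _ _ (hY j), zero_comp]

lemma IsIdempotentFree.op {X : 𝒜} (h : IsIdempotentFree X) :
    IsIdempotentFree (Opposite.op X) := by
  refine ⟨fun hz => h.1 hz.unop, fun e he => ?_⟩
  rcases h.2 e.unop (by rw [← unop_comp, he]) with h | h
  · left
    exact Quiver.Hom.unop_inj h
  · right
    exact Quiver.Hom.unop_inj h

/-- A section of a non-zero object into an object without idempotents can be retracted onto:
if `t ≫ r` is the identity of a non-zero object, then `r ≫ t` is the identity. -/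
lemma IsIdempotentFree.comp_eq_id {X Y : 𝒜} (hX : IsIdempotentFree X) (hY : ¬ IsZero Y)
    (t : Y ⟶ X) (r : X ⟶ Y) (h : t ≫ r = 𝟙 Y) : r ≫ t = 𝟙 X := by
  refine (hX.2 (r ≫ t) (by rw [Category.assoc, reassoc_of% h])).resolve_left fun h0 => hY ?_
  rw [IsZero.iff_id_eq_zero]
  calc 𝟙 Y = t ≫ (r ≫ t) ≫ r := by rw [Category.assoc, h, Category.comp_id, h]
    _ = 0 := by rw [h0, zero_comp, comp_zero]

/-- In an abelian category idempotents split, so that an indecomposable object has no idempotents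
besides `0` and the identity, and conversely. -/
lemma indecomposable_iff_isIdempotentFree {𝒜 : Type*} [Category 𝒜] [Abelian 𝒜] (X : 𝒜) :
    Indecomposable X ↔ IsIdempotentFree X := by
  refine and_congr_right fun hX => ⟨fun h e he => ?_, fun h Y Z a => ?_⟩
  · have h1 : (𝟙 X - e) ≫ (𝟙 X - e) = 𝟙 X - e := by
      simp [Preadditive.sub_comp, Preadditive.comp_sub, he]
    let r := factorThruImage e
    let m := image.ι e
    have hrm : r ≫ m = e := image.fac e
    have hmr : m ≫ r = 𝟙 _ := by
      rw [← cancel_epi r, ← cancel_mono m]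
      simp only [Category.assoc, hrm, reassoc_of% hrm, he, Category.comp_id]
    let r' := factorThruImage (𝟙 X - e)
    let m' := image.ι (𝟙 X - e)
    have hrm' : r' ≫ m' = 𝟙 X - e := image.fac (𝟙 X - e)
    have hmr' : m' ≫ r' = 𝟙 _ := by
      rw [← cancel_epi r', ← cancel_mono m']
      simp only [Category.assoc, hrm', reassoc_of% hrm', h1, Category.comp_id]
    have hmr0 : m ≫ r' = 0 := by
      rw [← cancel_epi r, ← cancel_mono m']
      simp only [Category.assoc, hrm', reassoc_of% hrm, comp_zero, zero_comp]
      simp [Preadditive.comp_sub, he]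
    have hmr0' : m' ≫ r = 0 := by
      rw [← cancel_epi r', ← cancel_mono m]
      simp only [Category.assoc, hrm, reassoc_of% hrm', comp_zero, zero_comp]
      simp [Preadditive.sub_comp, he]
    have hiso : X ≅ image e ⊞ image (𝟙 X - e) :=
      { hom := biprod.lift r r'
        inv := biprod.desc m m'
        hom_inv_id := by rw [biprod.lift_desc, hrm, hrm']; abel
        inv_hom_id := by
          apply biprod.hom_ext' <;> apply biprod.hom_ext <;> simp [hmr, hmr', hmr0, hmr0'] }
    rcases h _ _ hiso with hz | hz
    · left
      rw [← hrm, hz.eq_of_tgt r 0, zero_comp]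
    · right
      rw [← sub_eq_zero, ← neg_eq_zero, neg_sub, ← hrm', hz.eq_of_tgt r' 0, zero_comp]
  · have he := h (a.hom ≫ biprod.fst ≫ biprod.inl ≫ a.inv) (by simp)
    rcases he with he | he
    · left
      rw [IsZero.iff_id_eq_zero]
      have := (biprod.inl ≫ a.inv) ≫= he =≫ (a.hom ≫ biprod.fst)
      simpa using this
    · right
      rw [IsZero.iff_id_eq_zero]
      have := (biprod.inr ≫ a.inv) ≫= he =≫ (a.hom ≫ biprod.snd)
      simpa using this.symm

end FiniteSums

/-! ### Almost split maps and projective dimension in abelian categories -/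

section AlmostSplit

open Limits

variable {𝒜 : Type*} [Category 𝒜]

/-- `π : E ⟶ X` is right almost split with respect to the class `P` of objects: it is not a split
epimorphism, and every morphism from an object in `P` to `X` which is not a split epimorphism
factors through it. -/
def IsRightAlmostSplit (P : 𝒜 → Prop) {E X : 𝒜} (π : E ⟶ X) : Prop :=
  ¬ IsSplitEpi π ∧ ∀ (Y : 𝒜) (f : Y ⟶ X), P Y → ¬ IsSplitEpi f → ∃ g : Y ⟶ E, g ≫ π = f

/-- The dual of `IsRightAlmostSplit`. -/
def IsLeftAlmostSplit (P : 𝒜 → Prop) {X E : 𝒜} (σ : X ⟶ E) : Prop :=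
  ¬ IsSplitMono σ ∧ ∀ (Y : 𝒜) (f : X ⟶ Y), P Y → ¬ IsSplitMono f → ∃ g : E ⟶ Y, σ ≫ g = f

/-- `π` is right minimal: every endomorphism of its source over its target is invertible. -/
def IsRightMinimal {E X : 𝒜} (π : E ⟶ X) : Prop :=
  ∀ φ : E ⟶ E, φ ≫ π = π → IsIso φ

/-- The dual of `IsRightMinimal`. -/
def IsLeftMinimal {X E : 𝒜} (σ : X ⟶ E) : Prop :=
  ∀ φ : E ⟶ E, σ ≫ φ = σ → IsIso φ

lemma isSplitMono_of_op {X Y : 𝒜} {f : X ⟶ Y} (h : IsSplitEpi f.op) : IsSplitMono f := by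
  obtain ⟨⟨s⟩⟩ := h
  exact ⟨⟨⟨s.section_.unop, Quiver.Hom.op_inj s.id⟩⟩⟩

lemma isSplitEpi_op {X Y : 𝒜} {f : X ⟶ Y} (h : IsSplitMono f) : IsSplitEpi f.op := by
  obtain ⟨⟨s⟩⟩ := h
  exact ⟨⟨⟨s.retraction.op, Quiver.Hom.unop_inj s.id⟩⟩⟩

lemma IsLeftAlmostSplit.op {P : 𝒜 → Prop} {X E : 𝒜} {σ : X ⟶ E} (h : IsLeftAlmostSplit P σ) :
    IsRightAlmostSplit (fun X : 𝒜ᵒᵖ => P X.unop) σ.op := by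
  refine ⟨fun hs => h.1 (isSplitMono_of_op hs), fun Y f hY hf => ?_⟩
  obtain ⟨g, hg⟩ := h.2 Y.unop f.unop hY fun hs => hf (isSplitEpi_op hs)
  exact ⟨g.op, Quiver.Hom.unop_inj hg⟩

lemma IsLeftMinimal.op {X E : 𝒜} {σ : X ⟶ E} (h : IsLeftMinimal σ) : IsRightMinimal σ.op := by
  intro φ hφ
  have := h φ.unop (Quiver.Hom.op_inj hφ)
  exact (isIso_unop_iff φ).1 this

variable [Abelian 𝒜]

/-- A class `P` of objects of an abelian category which behaves like the class of finitely
generated modules over an artin algebra. The conditions are self-dual. -/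
structure IsLengthClass (P : 𝒜 → Prop) : Prop where
  of_mono : ∀ {X Y : 𝒜} (f : X ⟶ Y), Mono f → P Y → P X
  of_epi : ∀ {X Y : 𝒜} (f : X ⟶ Y), Epi f → P X → P Y
  of_shortExact : ∀ S : ShortComplex 𝒜, S.ShortExact → P S.X₁ → P S.X₃ → P S.X₂
  isFiniteSum : ∀ X : 𝒜, P X → IsFiniteSum (fun Y => P Y ∧ IsIdempotentFree Y) X
  enoughProjectives : ∀ X : 𝒜, P X → ∃ (Q : 𝒜) (p : Q ⟶ X), P Q ∧ Projective Q ∧ Epi p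
  enoughInjectives : ∀ X : 𝒜, P X → ∃ (J : 𝒜) (i : X ⟶ J), P J ∧ Injective J ∧ Mono i

lemma IsLengthClass.op {P : 𝒜 → Prop} (hP : IsLengthClass P) :
    IsLengthClass (fun X : 𝒜ᵒᵖ => P X.unop) where
  of_mono f _ h := hP.of_epi f.unop inferInstance h
  of_epi f _ h := hP.of_mono f.unop inferInstance h
  of_shortExact S hS h1 h3 := hP.of_shortExact S.unop hS.unop h3 h1
  isFiniteSum X hX := (hP.isFiniteSum X.unop hX).op.mono fun Y hY => ⟨hY.1, hY.2.op⟩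
  enoughProjectives X hX := by
    obtain ⟨J, i, hJ, _, _⟩ := hP.enoughInjectives X.unop hX
    exact ⟨.op J, i.op, hJ, inferInstance, inferInstanceAs (Epi i.op)⟩
  enoughInjectives X hX := by
    obtain ⟨Q, p, hQ, _, _⟩ := hP.enoughProjectives X.unop hX
    exact ⟨.op Q, p.op, hQ, inferInstance, inferInstanceAs (Mono p.op)⟩

lemma IsFiniteSum.hasProjectiveDimensionLT {C : 𝒜 → Prop} {E : 𝒜} (h : IsFiniteSum C E) (n : ℕ)
    (hC : ∀ X, C X → HasProjectiveDimensionLT X n) : HasProjectiveDimensionLT E n := by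
  obtain ⟨ι, _, Y, i, p, hY, h1, h0, hs⟩ := h
  let := HasExt.standard 𝒜
  rw [hasProjectiveDimensionLT_iff]
  intro m hm W e
  have key : ∀ j, (Abelian.Ext.mk₀ (i j)).comp e (zero_add m) = 0 := fun j =>
    have := hC _ (hY j)
    Abelian.Ext.eq_zero_of_hasProjectiveDimensionLT _ n hm
  rw [← Abelian.Ext.mk₀_id_comp e, ← hs, Abelian.Ext.mk₀_sum, Abelian.Ext.sum_comp]
  refine Finset.sum_eq_zero fun j _ => ?_
  rw [← Abelian.Ext.mk₀_comp_mk₀, Abelian.Ext.comp_assoc_of_second_deg_zero, key,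
    Abelian.Ext.comp_zero]

/-- The kernel sequence of an epimorphism. -/
lemma shortExact_kernel {X Y : 𝒜} (f : X ⟶ Y) [Epi f] :
    (ShortComplex.mk (kernel.ι f) f (kernel.condition f)).ShortExact :=
  { exact := ShortComplex.exact_kernel f }

lemma shortExact_cokernel {X Y : 𝒜} (f : X ⟶ Y) [Mono f] :
    (ShortComplex.mk f (cokernel.π f) (cokernel.condition f)).ShortExact :=
  { exact := ShortComplex.exact_cokernel f }

lemma IsLengthClass.hasInjectiveDimensionLT_of_op {P : 𝒜 → Prop} (hP : IsLengthClass P) (n : ℕ)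
    {Z : 𝒜} (hZ : P Z) (h : HasProjectiveDimensionLT (Opposite.op Z) (n + 1)) :
    HasInjectiveDimensionLT Z (n + 1) := by
  induction n generalizing Z with
  | zero =>
    rw [zero_add, ← injective_iff_hasInjectiveDimensionLT_one,
      Injective.injective_iff_projective_op]
    rwa [zero_add, ← projective_iff_hasProjectiveDimensionLT_one] at h
  | succ n ih =>
    obtain ⟨J, i, hJ, _, _⟩ := hP.enoughInjectives Z hZ
    have hS := shortExact_cokernel i
    rw [← hS.hasInjectiveDimensionLT_X₃_iff n inferInstance]
    refine ih (hP.of_epi (cokernel.π i) inferInstance hJ) ?_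
    exact (hS.op.hasProjectiveDimensionLT_X₃_iff n
      (inferInstanceAs (Projective (Opposite.op J)))).1 h

lemma IsLengthClass.hasProjectiveDimensionLT_of_op {P : 𝒜 → Prop} (hP : IsLengthClass P) (n : ℕ)
    {Z : 𝒜} (hZ : P Z) (h : HasInjectiveDimensionLT (Opposite.op Z) (n + 1)) :
    HasProjectiveDimensionLT Z (n + 1) := by
  induction n generalizing Z with
  | zero =>
    rw [zero_add, ← projective_iff_hasProjectiveDimensionLT_one,
      Injective.projective_iff_injective_op]
    rwa [zero_add, ← injective_iff_hasInjectiveDimensionLT_one] at h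
  | succ n ih =>
    obtain ⟨Q, p, hQ, _, _⟩ := hP.enoughProjectives Z hZ
    have hS := shortExact_kernel p
    rw [hS.hasProjectiveDimensionLT_X₃_iff n inferInstance]
    refine ih (hP.of_mono (kernel.ι p) inferInstance hQ) ?_
    exact (hS.op.hasInjectiveDimensionLT_X₃_iff n
      (inferInstanceAs (Injective (Opposite.op Q)))).2 h

lemma projective_of_isSplitMono_kernel {Q U : 𝒜} (q : Q ⟶ U) [Epi q] [Projective Q]
    (r : Q ⟶ kernel q) (hr : kernel.ι q ≫ r = 𝟙 _) : Projective U := by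
  let t : U ⟶ Q := (shortExact_kernel q).exact.desc (𝟙 Q - r ≫ kernel.ι q) (by
    simp [Preadditive.comp_sub, reassoc_of% hr])
  have ht : q ≫ t = 𝟙 Q - r ≫ kernel.ι q := (shortExact_kernel q).exact.g_desc _ _
  refine Retract.projective (Y := Q) ⟨t, q, ?_⟩
  rw [← cancel_epi q, reassoc_of% ht, Preadditive.sub_comp]
  simp

/-- An object of projective dimension at least two has a non-split extension by a quotient of an
injective object. -/
lemma IsLengthClass.exists_nonsplit_extension {P : 𝒜 → Prop} (hP : IsLengthClass P) {N : 𝒜}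
    (hN : P N) (hpd : ¬ HasProjectiveDimensionLT N 2) :
    ∃ (J S Y : 𝒜) (e : J ⟶ S) (a : S ⟶ Y) (y : Y ⟶ N) (w : a ≫ y = 0), P J ∧ Injective J ∧
      Epi e ∧ P Y ∧ (ShortComplex.mk a y w).ShortExact ∧ ¬ IsSplitEpi y := by
  obtain ⟨Q, f, hQ, _, _⟩ := hP.enoughProjectives N hN
  let u := kernel.ι f
  have hU : ¬ Projective (kernel f) := fun h =>
    hpd (((shortExact_kernel f).hasProjectiveDimensionLT_X₃_iff 0 inferInstance).2
      (by dsimp; infer_instance))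
  obtain ⟨Q', q, hQ', _, _⟩ := hP.enoughProjectives (kernel f) (hP.of_mono u inferInstance hQ)
  obtain ⟨J, m, hJ, _, _⟩ := hP.enoughInjectives (kernel q)
    (hP.of_mono (kernel.ι q) inferInstance hQ')
  let a : Q' ⟶ J := Injective.factorThru m (kernel.ι q)
  have ha : kernel.ι q ≫ a = m := Injective.comp_factorThru m (kernel.ι q)
  let e := cokernel.π m
  let b : kernel f ⟶ cokernel m := (shortExact_kernel q).exact.desc (a ≫ e)
    (by simp [reassoc_of% ha, e])
  have hb : q ≫ b = a ≫ e := (shortExact_kernel q).exact.g_desc _ _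
  -- `b` does not extend along `u`, since otherwise `q` would split
  have hext : ∀ c : Q ⟶ cokernel m, u ≫ c ≠ b := by
    intro c hc
    let c' : Q ⟶ J := Projective.factorThru c e
    have hc' : c' ≫ e = c := Projective.factorThru_comp c e
    let r : Q' ⟶ kernel q := (shortExact_cokernel m).exact.lift (a - q ≫ u ≫ c') (by
      change (a - q ≫ u ≫ c') ≫ e = 0
      simp [Preadditive.sub_comp, hc', hc, hb])
    have hr : r ≫ m = a - q ≫ u ≫ c' := ShortComplex.Exact.lift_f _ _ _
    refine hU (projective_of_isSplitMono_kernel q r ?_)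
    rw [← cancel_mono m, Category.assoc, hr]
    simp [Preadditive.comp_sub, ha]
  have hu : u ≫ f = 0 := kernel.condition f
  let y : pushout u b ⟶ N := pushout.desc f 0 (by simp [hu])
  have hy1 : pushout.inl u b ≫ y = f := pushout.inl_desc _ _ _
  have hy2 : pushout.inr u b ≫ y = 0 := pushout.inr_desc _ _ _
  have hyepi : Epi y := by
    have : Epi (pushout.inl u b ≫ y) := by rw [hy1]; infer_instance
    exact epi_of_epi (pushout.inl u b) y
  have hse : (ShortComplex.mk (pushout.inr u b) y hy2).ShortExact :=
    { exact := by
        refine ShortComplex.exact_of_g_is_cokernel _ (CokernelCofork.IsColimit.ofπ' _ _ ?_)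
        intro T k hk
        have h0 : u ≫ pushout.inl u b ≫ k = 0 := by
          rw [pushout.condition_assoc]
          simp only [] at hk
          rw [hk, comp_zero]
        refine ⟨(shortExact_kernel f).exact.desc (pushout.inl u b ≫ k) h0, ?_⟩
        apply pushout.hom_ext
        · rw [reassoc_of% hy1]
          exact (shortExact_kernel f).exact.g_desc _ _
        · rw [reassoc_of% hy2, zero_comp]
          exact hk.symm
      mono_f := inferInstanceAs (Mono (pushout.inr u b))
      epi_g := hyepi }
  refine ⟨J, cokernel m, pushout u b, e, pushout.inr u b, y, hy2, hJ, inferInstance, inferInstance,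
    hP.of_shortExact _ hse (hP.of_epi e inferInstance hJ) hN, hse, ?_⟩
  rintro ⟨⟨s, hs⟩⟩
  let c : Q ⟶ cokernel m := hse.exact.lift (pushout.inl u b - f ≫ s)
    (by simp [Preadditive.sub_comp, hy1, hs])
  have hc : c ≫ pushout.inr u b = pushout.inl u b - f ≫ s := ShortComplex.Exact.lift_f _ _ _
  refine hext c ?_
  rw [← cancel_mono (pushout.inr u b), Category.assoc, hc, Preadditive.comp_sub, reassoc_of% hu,
    zero_comp, sub_zero, pushout.condition]

/-- An object of injective dimension at least two has a non-split extension to a subobject of a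
projective object. -/
lemma IsLengthClass.exists_nonsplit_coextension {P : 𝒜 → Prop} (hP : IsLengthClass P) {Z : 𝒜}
    (hZ : P Z) (hid : ¬ HasInjectiveDimensionLT Z 2) :
    ∃ (Q U Y : 𝒜) (m : U ⟶ Q) (a : Z ⟶ Y) (y : Y ⟶ U) (w : a ≫ y = 0), P Q ∧ Projective Q ∧
      Mono m ∧ P Y ∧ (ShortComplex.mk a y w).ShortExact ∧ ¬ IsSplitMono a := by
  obtain ⟨J, S, Y, e, a, y, w, hJ, _, _, hY, hse, hns⟩ :=
    hP.op.exists_nonsplit_extension (N := .op Z) hZ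
      fun h => hid (hP.hasInjectiveDimensionLT_of_op 1 hZ h)
  exact ⟨J.unop, S.unop, Y.unop, e.unop, y.unop, a.unop, Quiver.Hom.op_inj w, hJ, inferInstance,
    inferInstance, hY, hse.unop, fun h => hns (isSplitEpi_op h)⟩

/-- The properties of a semi-regular component `C` without injectives and without external short
paths which are used to bound homological dimensions, for `P` the class of finitely generated
modules over the quotient by the annihilator of `C`. -/
structure IsPathClosedFaithfulClass (P C : 𝒜 → Prop) : Prop where
  no_short_path : ∀ (X Y Z : 𝒜) (f : X ⟶ Y) (g : Y ⟶ Z), C X → P Y → IsIdempotentFree Y → ¬ C Y →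
    C Z → f ≠ 0 → g = 0
  cogenerates : ∀ Q, P Q → Projective Q → ∃ (M : 𝒜) (i : Q ⟶ M), Mono i ∧ IsFiniteSum C M
  generates : ∀ J, P J → Injective J → ∃ (M : 𝒜) (e : M ⟶ J), Epi e ∧ IsFiniteSum C M
  not_injective : ∀ X, C X → ¬ Injective X
  almostSplit : ∀ X, P X → IsIdempotentFree X → ¬ Projective X →
    ∃ (E : 𝒜) (π : E ⟶ X), P E ∧ IsRightAlmostSplit P π ∧ IsRightMinimal π
  almostSplit_mem : ∀ X, C X → ¬ Projective X →
    ∃ (E : 𝒜) (π : E ⟶ X), IsFiniteSum C E ∧ IsRightAlmostSplit P π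

/-- If `π : E ⟶ N` is right almost split and `N` has projective dimension at least two, then a
non-zero morphism from an injective object to `E` is killed by `π`. -/
lemma IsLengthClass.exists_injective_comp_eq_zero {P : 𝒜 → Prop} (hP : IsLengthClass P) {N E : 𝒜}
    (hN : P N) (hpd : ¬ HasProjectiveDimensionLT N 2) {π : E ⟶ N} (hπ : IsRightAlmostSplit P π) :
    ∃ (J : 𝒜) (w : J ⟶ E), P J ∧ Injective J ∧ w ≠ 0 ∧ w ≫ π = 0 := by
  obtain ⟨J, S, Y, e, a, y, h0, hJ, hinj, he, hY, hse, hns⟩ := hP.exists_nonsplit_extension hN hpd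
  obtain ⟨θ, hθ⟩ := hπ.2 Y y hY hns
  refine ⟨J, e ≫ a ≫ θ, hJ, hinj, fun hw => hπ.1 ?_, by simp [hθ, h0]⟩
  have haθ : a ≫ θ = 0 := by rw [← cancel_epi e, hw, comp_zero]
  have : Epi y := hse.epi_g
  let s : N ⟶ E := hse.exact.desc θ haθ
  have hs : y ≫ s = θ := hse.exact.g_desc _ _
  exact ⟨⟨⟨s, by rw [← cancel_epi y, reassoc_of% hs, hθ, Category.comp_id]⟩⟩⟩

namespace IsPathClosedFaithfulClass

variable {P C : 𝒜 → Prop}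

/-- An indecomposable object with a non-zero morphism to an object of `C` has projective dimension
at most one. Otherwise some `X` in `C` would map non-trivially to the middle term `E` of the almost
split sequence ending at `N`, with image in the kernel of `π : E ⟶ N`. If `N` is not in `C`, then
the summands of `E` receiving morphisms from `C` compose to zero with `N ⟶ Z`, so that they map to
a proper subobject of `N`; minimality of `π` then makes `π` injective on them. -/
lemma hasProjectiveDimensionLT_two (hP : IsLengthClass P) (h : IsPathClosedFaithfulClass P C)
    {N Z : 𝒜} (hN : P N) (hNi : IsIdempotentFree N) (hZ : C Z) {g : N ⟶ Z} (hg : g ≠ 0) :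
    HasProjectiveDimensionLT N 2 := by
  by_contra hpd
  have hNp : ¬ Projective N := fun _ => hpd inferInstance
  by_cases hNC : C N
  · obtain ⟨E, π, hE, hπ⟩ := h.almostSplit_mem N hNC hNp
    obtain ⟨J, w, hJ, hinj, hw, -⟩ := hP.exists_injective_comp_eq_zero hN hpd hπ
    obtain ⟨Y, p, hY, hwp⟩ := hE.exists_to_ne_zero hw
    obtain ⟨J', r, ⟨hJ', hJi⟩, hi⟩ := (hP.isFiniteSum J hJ).exists_from_ne_zero hwp
    have hinj' : Injective J' := r.injective
    obtain ⟨M, c, hc, hM⟩ := h.generates J' hJ' hinj'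
    obtain ⟨X, x, hX, hx⟩ := hM.exists_from_ne_zero (f := c)
      fun h0 => hi (by rw [← cancel_epi c, h0, zero_comp, zero_comp])
    exact hi (h.no_short_path X J' Y (x.i ≫ c) _ hX hJ' hJi
      (fun hJC => h.not_injective J' hJC hinj') hY hx)
  · obtain ⟨E, π, hE, hπ, hmin⟩ := h.almostSplit N hN hNi hNp
    obtain ⟨J, w, hJ, hinj, hw, hwπ⟩ := hP.exists_injective_comp_eq_zero hN hpd hπ
    obtain ⟨M, c, hc, hM⟩ := h.generates J hJ hinj
    obtain ⟨X, x, hX, hx⟩ := hM.exists_from_ne_zero (f := c ≫ w)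
      fun h0 => hw (by rw [← cancel_epi c, h0, comp_zero])
    set v : X ⟶ E := x.i ≫ c ≫ w with hv
    have hvπ : v ≫ π = 0 := by simp [hv, hwπ]
    have hCN : ∀ (X : 𝒜) (f : X ⟶ N), C X → f = 0 := fun X f hX => by
      by_contra hf
      exact hg (h.no_short_path X N Z f g hX hN hNi hNC hZ hf)
    classical
    obtain ⟨ι, _, Y, i, p, hY, h1, h0, hs⟩ := hP.isFiniteSum E hE
    let s : Finset ι := {j | ∃ (X : 𝒜) (f : X ⟶ Y j), C X ∧ f ≠ 0}
    let e : E ⟶ E := ∑ j ∈ s, p j ≫ i j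
    have hpe : ∀ j ∈ s, i j ≫ e = i j := fun j hj => by
      rw [Preadditive.comp_sum, Finset.sum_eq_single j, reassoc_of% h1]
      · intro k _ hk
        rw [← Category.assoc, h0 j k hk.symm, zero_comp]
      · exact fun hj' => (hj' hj).elim
    have hee : e ≫ e = e := by
      conv_lhs => arg 1; change ∑ j ∈ s, p j ≫ i j
      rw [Preadditive.sum_comp]
      exact Finset.sum_congr rfl fun j hj => by rw [Category.assoc, hpe j hj]
    have hve : v ≫ e = v := by
      conv_rhs => rw [← Category.comp_id v, ← hs, Preadditive.comp_sum]
      rw [Preadditive.comp_sum]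
      refine Finset.sum_subset (Finset.subset_univ s) fun j _ hj => ?_
      rw [← Category.assoc]
      have : v ≫ p j = 0 := by
        by_contra hne
        exact hj (Finset.mem_filter.2 ⟨Finset.mem_univ j, X, _, hX, hne⟩)
      rw [this, zero_comp]
    have heg : e ≫ π ≫ g = 0 := by
      rw [Preadditive.sum_comp]
      refine Finset.sum_eq_zero fun j hj => ?_
      obtain ⟨X', f, hX', hf⟩ := (Finset.mem_filter.1 hj).2
      rw [Category.assoc]
      by_cases hjC : C (Y j)
      · rw [← Category.assoc (i j), hCN _ (i j ≫ π) hjC, zero_comp, comp_zero]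
      · rw [h.no_short_path X' (Y j) Z f (i j ≫ π ≫ g) hX' (hY j).1 (hY j).2 hjC hZ hf, comp_zero]
    let q := factorThruImage (e ≫ π)
    let m := image.ι (e ≫ π)
    have hqm : q ≫ m = e ≫ π := image.fac _
    have hmg : m ≫ g = 0 := by
      rw [← cancel_epi q, reassoc_of% hqm, comp_zero]
      exact heg
    have hmns : ¬ IsSplitEpi m := fun _ => hg (by rw [← cancel_epi m, hmg, comp_zero])
    obtain ⟨r, hr⟩ := hπ.2 _ m (hP.of_mono m inferInstance hN) hmns
    have hφ : (e ≫ q ≫ r + (𝟙 E - e)) ≫ π = π := by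
      simp only [Preadditive.add_comp, Preadditive.sub_comp, Category.assoc, hr, hqm,
        Category.id_comp, reassoc_of% hee]
      abel
    have := hmin _ hφ
    have hvq : v ≫ q = 0 := by
      rw [← cancel_mono m, Category.assoc, hqm, reassoc_of% hve, hvπ, zero_comp]
    refine hx ?_
    rw [← cancel_mono (e ≫ q ≫ r + (𝟙 E - e)), zero_comp]
    simp only [Preadditive.comp_add, Preadditive.comp_sub, hve, reassoc_of% hve, reassoc_of% hvq,
      zero_comp, Category.comp_id, sub_self, add_zero]

/-- Every subobject of a projective object has projective dimension at most one. -/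
lemma hasProjectiveDimensionLT_two_of_mono (hP : IsLengthClass P)
    (h : IsPathClosedFaithfulClass P C) {U Q : 𝒜} (m : U ⟶ Q) [Mono m] (hQ : P Q) [Projective Q] :
    HasProjectiveDimensionLT U 2 := by
  obtain ⟨M, i, _, hM⟩ := h.cogenerates Q hQ inferInstance
  obtain ⟨ι, _, Y, a, p, hY, h1, h0, hs⟩ := hP.isFiniteSum U (hP.of_mono m inferInstance hQ)
  refine IsFiniteSum.hasProjectiveDimensionLT (C := fun X => HasProjectiveDimensionLT X 2)
    ⟨ι, inferInstance, Y, a, p, fun j => ?_, h1, h0, hs⟩ 2 fun _ => id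
  have : Mono (a j) := mono_of_mono_fac (h1 j)
  have hne : a j ≫ m ≫ i ≠ 0 := fun h0 => (hY j).2.1 (by
    rw [IsZero.iff_id_eq_zero, ← cancel_mono (a j ≫ m ≫ i), h0, comp_zero, comp_zero])
  obtain ⟨Z, z, hZ, hz⟩ := hM.exists_to_ne_zero hne
  exact hasProjectiveDimensionLT_two hP h (hY j).1 (hY j).2 hZ hz

lemma hasProjectiveDimensionLT_three (hP : IsLengthClass P)
    (h : IsPathClosedFaithfulClass P C) {N : 𝒜} (hN : P N) : HasProjectiveDimensionLT N 3 := by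
  obtain ⟨Q, f, hQ, _, _⟩ := hP.enoughProjectives N hN
  exact ((shortExact_kernel f).hasProjectiveDimensionLT_X₃_iff 1 inferInstance).2
    (hasProjectiveDimensionLT_two_of_mono hP h (kernel.ι f) hQ)

/-- If `Z` has injective dimension at least two, then it has a non-split extension `Y` by a
subobject `U` of a projective object. Every indecomposable summand of `Y` maps non-trivially to `U`,
hence to `C`, so that `Y` and `U` have projective dimension at most one. Then so has `Z`. -/
lemma hasProjectiveDimensionLT_two_or (hP : IsLengthClass P)
    (h : IsPathClosedFaithfulClass P C) {Z : 𝒜} (hZ : P Z) (hZi : IsIdempotentFree Z) :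
    HasProjectiveDimensionLT Z 2 ∨ HasInjectiveDimensionLT Z 2 := by
  by_contra! hcon
  obtain ⟨Q, U, Y, m, a, y, h0, hQ, _, _, hY, hse, hns⟩ := hP.exists_nonsplit_coextension hZ hcon.2
  refine hcon.1 ?_
  have hU : HasProjectiveDimensionLT U 2 := hasProjectiveDimensionLT_two_of_mono hP h m hQ
  refine hse.hasProjectiveDimensionLT_X₁ 2 ?_ (hasProjectiveDimensionLT_of_ge U 2 3 (by norm_num))
  obtain ⟨M, i, _, hM⟩ := h.cogenerates Q hQ inferInstance
  obtain ⟨ι, _, W, t, p, hW, h1, h0', hs⟩ := hP.isFiniteSum Y hY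
  refine IsFiniteSum.hasProjectiveDimensionLT (C := fun X => HasProjectiveDimensionLT X 2)
    ⟨ι, inferInstance, W, t, p, fun j => ?_, h1, h0', hs⟩ 2 fun _ => id
  have hne : t j ≫ y ≠ 0 := by
    intro hty
    have : Mono a := hse.mono_f
    let b : W j ⟶ Z := hse.exact.lift (t j) hty
    have hb : b ≫ a = t j := hse.exact.lift_f _ _
    have hid := hZi.comp_eq_id (hW j).2.1 b (a ≫ p j) (by rw [reassoc_of% hb, h1])
    exact hns ⟨⟨⟨p j ≫ b, by rw [← hid, Category.assoc]⟩⟩⟩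
  have hne' : t j ≫ y ≫ m ≫ i ≠ 0 := fun h0 => hne (by
    rw [← cancel_mono (m ≫ i), zero_comp, Category.assoc, h0])
  obtain ⟨X, z, hX, hz⟩ := hM.exists_to_ne_zero hne'
  exact hasProjectiveDimensionLT_two hP h (hW j).1 (hW j).2 hX hz

end IsPathClosedFaithfulClass

end AlmostSplit

/-! ### Matlis duality over a commutative artinian ring -/

/-- A dualizing module: a finitely generated injective cogenerator `E` over `K` for which finitely
generated modules are reflexive with respect to `Hom(-, E)`. -/
structure IsDualizingModule (K E : Type u) [CommRing K] [AddCommGroup E] [Module K E] : Prop where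
  finite : Module.Finite K E
  injective : Module.Injective K E
  separates : ∀ (M : Type u) [AddCommGroup M] [Module K M] (m : M), m ≠ 0 →
    ∃ l : M →ₗ[K] E, l m ≠ 0
  eval_surjective : ∀ (M : Type u) [AddCommGroup M] [Module K M] [Module.Finite K M]
    (Φ : (M →ₗ[K] E) →ₗ[K] E), ∃ m : M, ∀ l, Φ l = l m

section Dualizing

variable {K : Type u} [CommRing K]

/-- An element killed by a maximal ideal is a multiple of each of its non-zero multiples. -/
lemma exists_smul_smul_eq {M : Type*} [AddCommGroup M] [Module K M] {m : Ideal K} (hm : m.IsMaximal)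
    {x : M} (hx : ∀ a ∈ m, a • x = 0) {r : K} (hr : r ∉ m) : ∃ s : K, s • r • x = x := by
  obtain ⟨s, a, ha, h⟩ := hm.exists_inv hr
  refine ⟨s, ?_⟩
  rw [smul_smul, ← add_zero ((s * r) • x), ← hx a ha, ← add_smul, h, one_smul]

/-- Any submodule `S` of an injective module `J` is contained in an injective submodule `E` which
has no elements killed by maximal ideals besides those of `S`. -/
lemma exists_injective_submodule_socle {J : Type u} [AddCommGroup J] [Module K J]
    (hJ : Module.Injective K J) (S : Submodule K J) :
    ∃ E : Submodule K J, S ≤ E ∧ Module.Injective K E ∧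
      ∀ x ∈ E, ∀ m : Ideal K, m.IsMaximal → (∀ a ∈ m, a • x = 0) → x ∈ S := by
  obtain ⟨E, hSE, hE⟩ := zorn_le_nonempty₀
    {E : Submodule K J | ∀ x ∈ E, ∀ m : Ideal K, m.IsMaximal → (∀ a ∈ m, a • x = 0) → x ∈ S}
    (fun c hc hchain E₀ hE₀ => ⟨sSup c, fun x hx m hm hmx => by
      obtain ⟨F, hF, hxF⟩ := (Submodule.mem_sSup_of_directed ⟨E₀, hE₀⟩ hchain.directedOn).1 hx
      exact hc hF x hxF m hm hmx, fun F hF => le_sSup hF⟩) S (fun x hx _ _ _ => hx)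
  refine ⟨E, hSE, ?_, hE.prop⟩
  -- `C` is a complement of `E` up to essential extensions
  obtain ⟨C, -, hC⟩ := zorn_le_nonempty₀ {C : Submodule K J | Disjoint C E}
    (fun c hc hchain E₀ hE₀ => ⟨sSup c, by
      rw [Set.mem_ofPred_eq, Submodule.disjoint_def]
      intro x hx hxE
      obtain ⟨F, hF, hxF⟩ := (Submodule.mem_sSup_of_directed ⟨E₀, hE₀⟩ hchain.directedOn).1 hx
      exact Submodule.disjoint_def.1 (hc hF) x hxF hxE, fun F hF => le_sSup hF⟩) ⊥ disjoint_bot_left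
  have hdisj : ∀ x ∈ C, x ∈ E → x = 0 := Submodule.disjoint_def.1 hC.prop
  obtain ⟨h, hh⟩ := hJ.out (C.mkQ ∘ₗ E.subtype) (by
    rw [← LinearMap.ker_eq_bot, LinearMap.ker_eq_bot']
    intro x hx
    exact Subtype.ext (hdisj x (by simpa using hx) x.2)) E.subtype
  have hhE : ∀ x ∈ E, h (C.mkQ x) = x := fun x hx => hh ⟨x, hx⟩
  have hker : ∀ z, h (C.mkQ z) = 0 → z ∈ C := by
    have hle : C ≤ LinearMap.ker (h ∘ₗ C.mkQ) := fun z hz => by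
      simp [(Submodule.Quotient.mk_eq_zero C).2 hz]
    have := hC.le_of_ge (y := LinearMap.ker (h ∘ₗ C.mkQ)) (by
      rw [Set.mem_ofPred_eq, Submodule.disjoint_def]
      intro x hx hxE
      rw [← hhE x hxE]
      exact hx) hle
    exact fun z hz => this hz
  have hEle : E ≤ LinearMap.range (h ∘ₗ C.mkQ) := fun x hx => ⟨x, hhE x hx⟩
  have hrange : LinearMap.range (h ∘ₗ C.mkQ) ≤ E := by
    refine hE.le_of_ge ?_ hEle
    rintro _ ⟨z, rfl⟩ m hm hmz
    by_cases hzC : z ∈ C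
    · simp [(Submodule.Quotient.mk_eq_zero C).2 hzC]
    have hmeet : ¬ Disjoint (C ⊔ K ∙ z) E := fun hd =>
      hzC (hC.le_of_ge hd le_sup_left
        (Submodule.mem_sup_right (Submodule.mem_span_singleton_self z)))
    rw [Submodule.disjoint_def] at hmeet
    push Not at hmeet
    obtain ⟨e, he, heE, hne⟩ := hmeet
    obtain ⟨c, hc, w, hw, rfl⟩ := Submodule.mem_sup.1 he
    obtain ⟨r, rfl⟩ := Submodule.mem_span_singleton.1 hw
    have hz : r • (h ∘ₗ C.mkQ) z = c + r • z := by
      rw [← hhE _ heE]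
      simp [(Submodule.Quotient.mk_eq_zero C).2 hc]
    have hr : r ∉ m := fun hr => hne (by rw [← hz, hmz r hr])
    obtain ⟨s, hs⟩ := exists_smul_smul_eq hm hmz hr
    have hmem : (h ∘ₗ C.mkQ) z ∈ E := by
      rw [← hs, hz]
      exact E.smul_mem s heE
    exact hE.prop _ hmem m hm hmz
  refine ⟨fun X Y _ _ _ _ f hf g => ?_⟩
  obtain ⟨l, hl⟩ := hJ.out f hf (E.subtype ∘ₗ g)
  refine ⟨((h ∘ₗ C.mkQ).codRestrict E fun z => hrange ⟨z, rfl⟩) ∘ₗ l, fun x => Subtype.ext ?_⟩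
  change h (C.mkQ (l (f x))) = g x
  rw [hl]
  exact hhE _ (g x).2

/-- The functor `Hom(-, E)` does not increase lengths if the elements of `E` killed by a given
maximal ideal are multiples of each other. -/
lemma length_linearMap_le {E : Type u} [AddCommGroup E] [Module K E]
    (hE : ∀ m : Ideal K, m.IsMaximal → ∀ x y : E, (∀ a ∈ m, a • x = 0) → (∀ a ∈ m, a • y = 0) →
      x ≠ 0 → ∃ a : K, y = a • x)
    {M : Type u} [AddCommGroup M] [Module K M] (hM : IsFiniteLength K M) :
    Module.length K (M →ₗ[K] E) ≤ Module.length K M := by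
  induction hM with
  | of_subsingleton =>
    have : Subsingleton (‹Type u› →ₗ[K] E) := inferInstance
    simp [Module.length_eq_zero]
  | @of_simple_quotient M _ _ N hs hN ih =>
    have hq : Module.length K ((M ⧸ N) →ₗ[K] E) ≤ 1 := by
      obtain ⟨m, hm, ⟨e⟩⟩ := isSimpleModule_iff_quot_maximal.1 hs
      have hgen : ∀ f : (M ⧸ N) →ₗ[K] E, ∀ a ∈ m, a • f (e.symm 1) = 0 := fun f a ha => by
        rw [← map_smul, ← map_smul]
        have : a • (1 : K ⧸ m) = 0 := by
          rw [Algebra.smul_def, mul_one]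
          exact Ideal.Quotient.eq_zero_iff_mem.2 ha
        rw [this, map_zero, map_zero]
      have hext : ∀ f g : (M ⧸ N) →ₗ[K] E, f (e.symm 1) = g (e.symm 1) → f = g := by
        intro f g hfg
        have : f ∘ₗ e.symm.toLinearMap = g ∘ₗ e.symm.toLinearMap := by
          apply Submodule.linearMap_qext
          ext
          simpa using hfg
        refine LinearMap.ext fun x => ?_
        simpa using LinearMap.congr_fun this (e x)
      by_cases hsub : Subsingleton ((M ⧸ N) →ₗ[K] E)
      · rw [Module.length_eq_zero]
        exact zero_le_one
      rw [not_subsingleton_iff_nontrivial] at hsub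
      have : IsSimpleModule K ((M ⧸ N) →ₗ[K] E) := by
        refine isSimpleModule_iff_toSpanSingleton_surjective.2 ⟨hsub, fun f hf g => ?_⟩
        obtain ⟨a, ha⟩ := hE m hm _ _ (hgen f) (hgen g) fun h0 => hf (hext f 0 (by simpa using h0))
        exact ⟨a, hext _ _ (by simpa using ha.symm)⟩
      rw [Module.length_eq_one_iff.2 this]
    let r : (M →ₗ[K] E) →ₗ[K] (N →ₗ[K] E) := LinearMap.lcomp K E N.subtype
    let i : ((M ⧸ N) →ₗ[K] E) →ₗ[K] (M →ₗ[K] E) := LinearMap.lcomp K E N.mkQ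
    have hi : Function.Injective i := fun f g hfg => by
      apply Submodule.linearMap_qext
      exact hfg
    have hex : Function.Exact i r.rangeRestrict := by
      intro f
      constructor
      · intro hf
        have hf' : N ≤ LinearMap.ker f := fun x hx =>
          LinearMap.congr_fun (congrArg Subtype.val hf) ⟨x, hx⟩
        exact ⟨N.liftQ f hf', N.liftQ_mkQ f hf'⟩
      · rintro ⟨g, rfl⟩
        refine Subtype.ext (LinearMap.ext fun x => ?_)
        change g (N.mkQ x) = 0
        rw [Submodule.mkQ_apply, (Submodule.Quotient.mk_eq_zero N).2 x.2, map_zero]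
    rw [Module.length_eq_add_of_exact i r.rangeRestrict hi r.surjective_rangeRestrict hex,
      Module.length_eq_add_of_exact N.subtype N.mkQ N.injective_subtype N.mkQ_surjective
        (LinearMap.exact_subtype_mkQ N), add_comm,
      Module.length_eq_one_iff.2 hs]
    exact add_le_add ((Module.length_le_of_injective _ (Submodule.injective_subtype _)).trans ih) hq

/-- A commutative artinian ring has a dualizing module: the injective hull of the sum of its simple
modules. -/
theorem exists_isDualizingModule (K : Type u) [CommRing K] [IsArtinianRing K] :
    ∃ (E : Type u) (_ : AddCommGroup E) (_ : Module K E), IsDualizingModule K E := by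
  classical
  let T := (m : MaximalSpectrum K) → K ⧸ m.asIdeal
  have : Fintype (MaximalSpectrum K) := Fintype.ofFinite _
  obtain ⟨⟨J, _, s, hs⟩⟩ := EnoughInjectives.presentation (ModuleCat.of K T)
  rw [ModuleCat.mono_iff_injective] at hs
  obtain ⟨E, hSE, hinj, hsoc⟩ := exists_injective_submodule_socle
    (Module.injective_module_of_injective_object K J) (LinearMap.range s.hom)
  -- an element of `T` killed by a maximal ideal is concentrated in one component
  have hT : ∀ (m : Ideal K) (hm : m.IsMaximal) (t : T), (∀ a ∈ m, a • t = 0) →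
      ∀ m' : MaximalSpectrum K, m' ≠ ⟨m, hm⟩ → t m' = 0 := by
    intro m hm t ht m' hne
    have : ∃ a ∈ m, a ∉ m'.asIdeal := by
      by_contra! hle
      exact hne (MaximalSpectrum.ext (hm.eq_of_le m'.isMaximal.ne_top hle).symm)
    obtain ⟨a, ha, ha'⟩ := this
    obtain ⟨b, hb⟩ := exists_smul_smul_eq m'.isMaximal (x := t m') (fun c hc => by
      obtain ⟨d, hd⟩ := Ideal.Quotient.mk_surjective (t m')
      rw [← hd, Algebra.smul_def, Ideal.Quotient.algebraMap_eq, ← map_mul]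
      exact Ideal.Quotient.eq_zero_iff_mem.2 (m'.asIdeal.mul_mem_right d hc)) ha'
    rw [← hb, show a • t m' = 0 from congrFun (ht a ha) m', smul_zero]
  have hone : ∀ m : Ideal K, m.IsMaximal → ∀ x y : E, (∀ a ∈ m, a • x = 0) →
      (∀ a ∈ m, a • y = 0) → x ≠ 0 → ∃ a : K, y = a • x := by
    rintro m hm ⟨x, hxE⟩ ⟨y, hyE⟩ hx hy hne
    obtain ⟨t, rfl⟩ := hsoc x hxE m hm fun a ha => congrArg Subtype.val (hx a ha)
    obtain ⟨t', rfl⟩ := hsoc y hyE m hm fun a ha => congrArg Subtype.val (hy a ha)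
    have ht : ∀ a ∈ m, a • t = 0 := fun a ha => hs (by
      rw [map_zero]
      exact (map_smul s.hom a t).trans (congrArg Subtype.val (hx a ha)))
    have ht' : ∀ a ∈ m, a • t' = 0 := fun a ha => hs (by
      rw [map_zero]
      exact (map_smul s.hom a t').trans (congrArg Subtype.val (hy a ha)))
    have htm : t ⟨m, hm⟩ ≠ 0 := fun h0 => hne (Subtype.ext (by
      have : t = 0 := funext fun m' => by
        by_cases h : m' = ⟨m, hm⟩
        · rw [h, h0]
          rfl
        · exact hT m hm t ht m' h
      exact (congrArg s.hom this).trans (map_zero s.hom)))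
    obtain ⟨c, hc⟩ := Ideal.Quotient.mk_surjective (t ⟨m, hm⟩)
    obtain ⟨d, hd⟩ := Ideal.Quotient.mk_surjective (t' ⟨m, hm⟩)
    have hcm : c ∉ m := fun h => htm (by rw [← hc]; exact Ideal.Quotient.eq_zero_iff_mem.2 h)
    obtain ⟨b, a, ha, hb⟩ := hm.exists_inv hcm
    refine ⟨d * b, Subtype.ext ?_⟩
    change s.hom t' = (d * b) • s.hom t
    rw [← map_smul]
    congr 1
    funext m'
    by_cases h : m' = ⟨m, hm⟩
    · subst h
      rw [Pi.smul_apply, ← hc, ← hd, Algebra.smul_def, Ideal.Quotient.algebraMap_eq, ← map_mul]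
      refine Ideal.Quotient.eq.2 ?_
      have : d - d * b * c = d * a := by linear_combination d * hb.symm
      rw [this]
      exact m.mul_mem_left d ha
    · rw [Pi.smul_apply, hT m hm t' ht' m' h, hT m hm t ht m' h, smul_zero]
  have hsep : ∀ (M : Type u) [AddCommGroup M] [Module K M] (x : M), x ≠ 0 →
      ∃ l : M →ₗ[K] E, l x ≠ 0 := by
    intro M _ _ x hx
    let f := LinearMap.toSpanSingleton K M x
    obtain ⟨m, hm, hle⟩ := Ideal.exists_le_maximal (LinearMap.ker f) fun h =>
      hx (by simpa [f] using (Ideal.eq_top_iff_one _).1 h)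
    let g : K →ₗ[K] E := LinearMap.toSpanSingleton K E
      ⟨s.hom (Pi.single ⟨m, hm⟩ 1), hSE ⟨_, rfl⟩⟩
    have hg : LinearMap.ker f ≤ LinearMap.ker g := fun a ha => by
      rw [LinearMap.mem_ker]
      refine Subtype.ext ?_
      change a • s.hom (Pi.single ⟨m, hm⟩ 1 : T) = 0
      rw [← map_smul, ← Pi.single_smul, Algebra.smul_def, mul_one, Ideal.Quotient.algebraMap_eq,
        Ideal.Quotient.eq_zero_iff_mem.2 (hle ha), Pi.single_zero]
      exact map_zero s.hom
    obtain ⟨l, hl⟩ := hinj.out ((LinearMap.ker f).liftQ f le_rfl)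
      (LinearMap.ker_eq_bot.1 (Submodule.ker_liftQ_eq_bot _ _ _ le_rfl))
      ((LinearMap.ker f).liftQ g hg)
    refine ⟨l, fun h0 => ?_⟩
    have h1 := hl ((LinearMap.ker f).mkQ 1)
    rw [Submodule.mkQ_apply, Submodule.liftQ_apply, Submodule.liftQ_apply] at h1
    simp only [f, g, LinearMap.toSpanSingleton_apply, one_smul, h0] at h1
    have h2 : (Pi.single ⟨m, hm⟩ 1 : T) = 0 := hs (by
      rw [map_zero]
      exact (congrArg Subtype.val h1).symm)
    have h3 := congrFun h2 ⟨m, hm⟩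
    rw [Pi.single_eq_same] at h3
    exact hm.ne_top ((Ideal.eq_top_iff_one m).2 (Ideal.Quotient.eq_zero_iff_mem.1 h3))
  have hlen : ∀ (M : Type u) [AddCommGroup M] [Module K M], IsFiniteLength K M →
      IsFiniteLength K (M →ₗ[K] E) := fun M _ _ hM => by
    rw [← Module.length_ne_top_iff] at hM ⊢
    exact ne_top_of_le_ne_top hM (length_linearMap_le hone (Module.length_ne_top_iff.1 hM))
  have hfin : ∀ (M : Type u) [AddCommGroup M] [Module K M] [Module.Finite K M],
      IsFiniteLength K M := fun M _ _ _ =>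
    isFiniteLength_iff_isNoetherian_isArtinian.2 ⟨inferInstance, inferInstance⟩
  refine ⟨E, inferInstance, inferInstance, ?_, hinj, hsep, ?_⟩
  · have := (hlen K (hfin K)).of_surjective (LinearMap.ringLmapEquivSelf K K E).surjective
    have := (isFiniteLength_iff_isNoetherian_isArtinian.1 this).1
    infer_instance
  · intro M _ _ _ Φ
    let ev : M →ₗ[K] ((M →ₗ[K] E) →ₗ[K] E) := LinearMap.applyₗ
    have hev : Function.Injective ev := by
      rw [← LinearMap.ker_eq_bot, LinearMap.ker_eq_bot']
      intro x hx
      by_contra hne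
      obtain ⟨l, hl⟩ := hsep M x hne
      exact hl (LinearMap.congr_fun hx l)
    have h1 := hlen M (hfin M)
    obtain ⟨_, _⟩ := isFiniteLength_iff_isNoetherian_isArtinian.1 (hlen _ h1)
    have hsurj : LinearMap.range ev = ⊤ := by
      by_contra hne
      have h2 := Submodule.length_lt hne
      rw [← (LinearEquiv.ofInjective ev hev).length_eq] at h2
      exact absurd ((length_linearMap_le hone h1).trans (length_linearMap_le hone (hfin M)))
        (not_le.2 h2)
    obtain ⟨x, hx⟩ := LinearMap.range_eq_top.1 hsurj Φ
    exact ⟨x, fun l => by rw [← hx]; rfl⟩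

end Dualizing

/-! ### Endomorphisms of modules of finite length without idempotents -/

section Endomorphisms

/-- Fitting's lemma: an endomorphism of a module of finite length whose only idempotent
endomorphisms are `0` and `1` is nilpotent unless it is bijective. -/
lemma isNilpotent_of_not_bijective {R N : Type*} [Ring R] [AddCommGroup N] [Module R N]
    [IsNoetherian R N] [IsArtinian R N]
    (hN : ∀ e : Module.End R N, IsIdempotentElem e → e = 0 ∨ e = 1) {f : Module.End R N}
    (hf : ¬ Function.Bijective f) : IsNilpotent f := by
  obtain ⟨n, hn⟩ := Filter.eventually_atTop.1 f.eventually_isCompl_ker_pow_range_pow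
  have hc := hn (n + 1) (Nat.le_succ n)
  let e : Module.End R N := (LinearMap.ker (f ^ (n + 1))).subtype ∘ₗ
    (LinearMap.ker (f ^ (n + 1))).projectionOnto _ hc
  have he : IsIdempotentElem e := LinearMap.ext fun x =>
    congrArg Subtype.val (Submodule.projectionOnto_apply_left hc _)
  rcases hN e he with h0 | h1
  · refine absurd ?_ hf
    have hinj : Function.Injective f := by
      rw [← LinearMap.ker_eq_bot, LinearMap.ker_eq_bot']
      intro x hx
      have hx' : x ∈ LinearMap.ker (f ^ (n + 1)) := by
        rw [LinearMap.mem_ker, pow_succ, Module.End.mul_apply, hx, map_zero]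
      have := LinearMap.congr_fun h0 x
      rw [show e x = _ from congrArg Subtype.val
        (Submodule.projectionOnto_apply_left hc ⟨x, hx'⟩)] at this
      exact this
    exact IsArtinian.bijective_of_injective_endomorphism f hinj
  · refine ⟨n + 1, LinearMap.ext fun x => ?_⟩
    rw [← Module.End.one_apply (R := R) x, ← h1]
    exact LinearMap.mem_ker.1 (Submodule.coe_mem _)

variable {K R N : Type u} [CommRing K] [Ring R] [Algebra K R] [AddCommGroup N] [Module R N]
  [Module K N] [IsScalarTower K R N]

/-- The endomorphism ring of an indecomposable module carries a linear functional which does not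
vanish at the identity, but at every endomorphism which is not bijective. -/
lemma exists_functional_end {E : Type u} [AddCommGroup E] [Module K E]
    (hE : IsDualizingModule K E) [Nontrivial N] [IsNoetherian R N] [IsArtinian R N]
    (hN : ∀ e : Module.End R N, IsIdempotentElem e → e = 0 ∨ e = 1) :
    ∃ φ : (N →ₗ[R] N) →ₗ[K] E, φ LinearMap.id ≠ 0 ∧
      ∀ f : N →ₗ[R] N, ¬ Function.Bijective f → φ f = 0 := by
  have hbij : ∀ {f : N →ₗ[R] N}, Function.Injective f → Function.Bijective f := fun {f} hf =>
    IsArtinian.bijective_of_injective_endomorphism f hf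
  let J : Submodule K (N →ₗ[R] N) :=
    { carrier := {f | ¬ Function.Bijective f}
      zero_mem' := fun h => by
        obtain ⟨x, hx⟩ := exists_ne (0 : N)
        exact hx (h.1 (by simp))
      smul_mem' := fun a f hf h => hf (hbij (by
        rw [← LinearMap.ker_eq_bot, LinearMap.ker_eq_bot']
        intro x hx
        exact h.1 (by simp [hx])))
      add_mem' := by
        intro f g hf hg h
        let u := LinearEquiv.ofBijective (f + g) h
        have hu : ∀ x, u.symm (f x) + u.symm (g x) = x := fun x => by
          rw [← map_add]
          exact u.symm_apply_apply x
        have hf' : ¬ Function.Bijective (u.symm.toLinearMap ∘ₗ f) := fun hb => hf (hbij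
          (Function.Injective.of_comp (f := u.symm) hb.1))
        have h1 := (isNilpotent_of_not_bijective hN hf').isUnit_one_sub
        have h2 : (1 : Module.End R N) - u.symm.toLinearMap ∘ₗ f = u.symm.toLinearMap ∘ₗ g :=
          LinearMap.ext fun x => by
            rw [LinearMap.sub_apply, Module.End.one_apply]
            nth_rewrite 1 [← hu x]
            simp
        rw [h2, Module.End.isUnit_iff] at h1
        exact hg (hbij (Function.Injective.of_comp (f := u.symm) h1.1)) }
  have hid : J.mkQ LinearMap.id ≠ 0 := by
    rw [Submodule.mkQ_apply, Ne, Submodule.Quotient.mk_eq_zero]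
    exact fun h => h Function.bijective_id
  obtain ⟨l, hl⟩ := hE.separates _ _ hid
  refine ⟨l ∘ₗ J.mkQ, hl, fun f hf => ?_⟩
  rw [LinearMap.comp_apply, Submodule.mkQ_apply, (Submodule.Quotient.mk_eq_zero J).2 hf, map_zero]

end Endomorphisms

/-! ### Coinduced modules -/

section Coinduced

/-- The left `R`-module `Hom_K(R, E)`, on which `R` acts through right multiplication on the
argument. -/
def Coinduced (K R E : Type u) [CommRing K] [Ring R] [Algebra K R] [AddCommGroup E] [Module K E] :
    Type u :=
  R →ₗ[K] E

variable {K R E : Type u} [CommRing K] [Ring R] [Algebra K R] [AddCommGroup E] [Module K E]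

instance : AddCommGroup (Coinduced K R E) := inferInstanceAs (AddCommGroup (R →ₗ[K] E))

instance : Module K (Coinduced K R E) := inferInstanceAs (Module K (R →ₗ[K] E))

instance : FunLike (Coinduced K R E) R E := inferInstanceAs (FunLike (R →ₗ[K] E) R E)

instance : LinearMapClass (Coinduced K R E) K R E :=
  inferInstanceAs (LinearMapClass (R →ₗ[K] E) K R E)

@[simp]
lemma Coinduced.add_apply (f g : Coinduced K R E) (r : R) : (f + g) r = f r + g r := rfl

@[simp]
lemma Coinduced.zero_apply (r : R) : (0 : Coinduced K R E) r = 0 := rfl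

lemma Coinduced.smul_apply' (a : K) (f : Coinduced K R E) (r : R) : (a • f) r = a • f r := rfl

lemma Coinduced.sum_apply {ι : Type*} (s : Finset ι) (f : ι → Coinduced K R E) (r : R) :
    (∑ i ∈ s, f i) r = ∑ i ∈ s, f i r :=
  LinearMap.sum_apply (M := R) (M₂ := E) s f r

@[ext]
lemma Coinduced.ext {f g : Coinduced K R E} (h : ∀ r, f r = g r) : f = g :=
  LinearMap.ext (f := f) (g := g) h

instance : SMul R (Coinduced K R E) where
  smul r f := (show R →ₗ[K] E from f) ∘ₗ LinearMap.mulRight K r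

@[simp]
lemma Coinduced.smul_apply (r : R) (f : Coinduced K R E) (s : R) : (r • f) s = f (s * r) := rfl

instance : Module R (Coinduced K R E) where
  one_smul f := by ext s; simp
  mul_smul r t f := by ext s; simp [mul_assoc]
  smul_zero r := by ext s; simp
  smul_add r f g := by ext s; simp
  add_smul r t f := by ext s; simp [mul_add]
  zero_smul f := by ext s; simp

instance : IsScalarTower K R (Coinduced K R E) where
  smul_assoc a r f := by
    ext s
    rw [Coinduced.smul_apply, Coinduced.smul_apply', Coinduced.smul_apply, mul_smul_comm, map_smul]

/-- A functional on an `R`-module `Y` is the same as a homomorphism to the coinduced module. -/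
def Coinduced.lift {Y : Type*} [AddCommGroup Y] [Module R Y] [Module K Y] [IsScalarTower K R Y]
    (l : Y →ₗ[K] E) : Y →ₗ[R] Coinduced K R E where
  toFun y := l ∘ₗ (LinearMap.toSpanSingleton R Y y).restrictScalars K
  map_add' x y := by
    ext r
    exact (congrArg l (smul_add r x y)).trans (map_add l _ _)
  map_smul' r y := by
    ext s
    exact congrArg l (smul_smul s r y)

@[simp]
lemma Coinduced.lift_apply {Y : Type*} [AddCommGroup Y] [Module R Y] [Module K Y]
    [IsScalarTower K R Y] (l : Y →ₗ[K] E) (y : Y) (r : R) :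
    Coinduced.lift (R := R) l y r = l (r • y) :=
  rfl

lemma IsDualizingModule.injective_coinduced (hE : IsDualizingModule K E) (n : ℕ) :
    Module.Injective R (Fin n → Coinduced K R E) where
  out X Y _ _ _ _ f hf g := by
    let _ : Module K X := Module.compHom X (algebraMap K R)
    let _ : Module K Y := Module.compHom Y (algebraMap K R)
    have _ : IsScalarTower K R X := IsScalarTower.of_compHom K R X
    have _ : IsScalarTower K R Y := IsScalarTower.of_compHom K R Y
    have key : ∀ i, ∃ l : Y →ₗ[K] E, ∀ x, l (f x) = g x i 1 := fun i => by
      let l : X →ₗ[K] E :=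
        { toFun := fun x => g x i 1
          map_add' := fun x y => by simp
          map_smul' := fun a x => by
            rw [← algebraMap_smul R a x, map_smul, Pi.smul_apply, Coinduced.smul_apply, one_mul,
              Algebra.algebraMap_eq_smul_one, map_smul]
            rfl }
      exact hE.injective.out (f.restrictScalars K) hf l
    choose l hl using key
    refine ⟨LinearMap.pi fun i => Coinduced.lift (l i), fun x => funext fun i => ?_⟩
    ext r
    simp only [LinearMap.pi_apply, Coinduced.lift_apply]
    rw [← map_smul, hl, map_smul, Pi.smul_apply, Coinduced.smul_apply, one_mul]

/-- If `K` is artinian then finitely generated modules over finite `K`-algebras embed into finitely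
generated injective modules. -/
lemma IsDualizingModule.exists_injective [IsArtinianRing K] [Module.Finite K R]
    (hE : IsDualizingModule K E) (L : Type u) [AddCommGroup L] [Module R L] [Module.Finite R L] :
    ∃ (J : Type u) (_ : AddCommGroup J) (_ : Module R J) (i : L →ₗ[R] J),
      Module.Finite R J ∧ Module.Injective R J ∧ Function.Injective i := by
  let _ : Module K L := Module.compHom L (algebraMap K R)
  have _ : IsScalarTower K R L := IsScalarTower.of_compHom K R L
  have : Module.Finite K L := Module.Finite.trans R L
  have := hE.finite
  obtain ⟨n, l, hl⟩ := Module.Finite.exists_fin (R := K) (M := L →ₗ[K] E)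
  have : Module.Finite K (Coinduced K R E) := inferInstanceAs (Module.Finite K (R →ₗ[K] E))
  have : Module.Finite R (Coinduced K R E) := Module.Finite.of_restrictScalars_finite K R _
  refine ⟨Fin n → Coinduced K R E, inferInstance, inferInstance,
    LinearMap.pi fun i => Coinduced.lift (l i), inferInstance, hE.injective_coinduced n, ?_⟩
  rw [← LinearMap.ker_eq_bot, LinearMap.ker_eq_bot']
  intro x hx
  by_contra hne
  obtain ⟨k, hk⟩ := hE.separates L x hne
  refine hk ?_
  have hle : Submodule.span K (Set.range l) ≤ LinearMap.ker (LinearMap.applyₗ x) := by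
    rw [Submodule.span_le]
    rintro _ ⟨i, rfl⟩
    have : Coinduced.lift (R := R) (l i) x 1 = 0 := by
      rw [show Coinduced.lift (R := R) (l i) x = 0 from congrFun hx i, Coinduced.zero_apply]
    simpa using this
  exact hle (hl ▸ Submodule.mem_top)

end Coinduced

/-! ### Existence of almost split maps -/

section AlmostSplitModules

/-- A homomorphism to an injective module factors through any homomorphism with smaller kernel. -/
lemma exists_comp_eq_of_ker_le {K E : Type u} [Ring K] [AddCommGroup E] [Module K E]
    (hE : Module.Injective K E) {U V : Type u} [AddCommGroup U] [Module K U] [AddCommGroup V]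
    [Module K V] (a : U →ₗ[K] V) (b : U →ₗ[K] E) (h : ∀ x, a x = 0 → b x = 0) :
    ∃ c : V →ₗ[K] E, ∀ x, c (a x) = b x := by
  have hle : LinearMap.ker a ≤ LinearMap.ker b := fun x hx => h x hx
  obtain ⟨c, hc⟩ := hE.out ((LinearMap.ker a).liftQ a le_rfl)
    (LinearMap.ker_eq_bot.1 (Submodule.ker_liftQ_eq_bot _ _ _ le_rfl))
    ((LinearMap.ker a).liftQ b hle)
  exact ⟨c, fun x => by simpa using hc ((LinearMap.ker a).mkQ x)⟩

variable {K R E : Type u} [CommRing K] [Ring R] [Algebra K R] [AddCommGroup E] [Module K E]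

/-- If `x` is a family of generators of `N` and `d` a family of generators of their relations, then
a family `y` of elements of `Y` which satisfies the relations `d` is the image of `x` under a
homomorphism. -/
lemma exists_linearMap_of_relations {N Y : Type*} [AddCommGroup N] [Module R N] [AddCommGroup Y]
    [Module R Y] {n m : ℕ} {x : Fin n → N} (hx : Submodule.span R (Set.range x) = ⊤)
    {d : Fin m → Fin n → R}
    (hd : LinearMap.ker (Fintype.linearCombination R x) ≤ Submodule.span R (Set.range d))
    {y : Fin n → Y} (hy : ∀ k, ∑ i, d k i • y i = 0) : ∃ h : N →ₗ[R] Y, ∀ i, h (x i) = y i := by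
  have hsurj : LinearMap.range (Fintype.linearCombination R x) = ⊤ := by
    rw [Fintype.range_linearCombination, hx]
  have hle : LinearMap.ker (Fintype.linearCombination R x) ≤
      LinearMap.ker (Fintype.linearCombination R y) := by
    refine hd.trans (Submodule.span_le.2 ?_)
    rintro _ ⟨k, rfl⟩
    exact hy k
  let e := (Fintype.linearCombination R x).quotKerEquivOfSurjective (LinearMap.range_eq_top.1 hsurj)
  refine ⟨(LinearMap.ker _).liftQ _ hle ∘ₗ e.symm.toLinearMap, fun i => ?_⟩
  classical
  have : e.symm (x i) = (LinearMap.ker (Fintype.linearCombination R x)).mkQ (Pi.single i 1) := by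
    rw [LinearEquiv.symm_apply_eq]
    simp [e]
  rw [LinearMap.comp_apply, LinearEquiv.coe_coe, this]
  simp

variable [IsArtinianRing K] [Module.Finite K R] {N : Type u} [AddCommGroup N] [Module R N]
  [Module.Finite R N] [Nontrivial N]

/-- Existence of right almost split homomorphisms. For a presentation `R^m → R^n → N` of `N` and a
functional `φ` on the endomorphism ring of `N` which vanishes at the non-units, `M` is the pullback
of `Hom_K(R, E)^m → Hom_K(R, E)^n` along the homomorphism `N → Hom_K(R, E)^n` which belongs to an
extension of `φ` from `Hom_R(N, N)` to `Hom_R(R^n, N)`. -/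
theorem IsDualizingModule.exists_rightAlmostSplit (hE : IsDualizingModule K E)
    (hN : ∀ e : Module.End R N, IsIdempotentElem e → e = 0 ∨ e = 1) :
    ∃ (M : Type u) (_ : AddCommGroup M) (_ : Module R M) (π : M →ₗ[R] N), Module.Finite R M ∧
      (¬ ∃ s : N →ₗ[R] M, π ∘ₗ s = LinearMap.id) ∧
      ∀ (Y : Type u) [AddCommGroup Y] [Module R Y] (f : Y →ₗ[R] N),
        (¬ ∃ s : N →ₗ[R] Y, f ∘ₗ s = LinearMap.id) → ∃ g : Y →ₗ[R] M, π ∘ₗ g = f := by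
  classical
  let _ : Module K N := Module.compHom N (algebraMap K R)
  have _ : IsScalarTower K R N := IsScalarTower.of_compHom K R N
  have : Module.Finite K N := Module.Finite.trans R N
  have := hE.finite
  have : IsNoetherian R N := isNoetherian_of_tower K inferInstance
  have : IsArtinian R N := isArtinian_of_tower K inferInstance
  have : IsNoetherianRing R := isNoetherian_of_tower K inferInstance
  obtain ⟨φ, hφ1, hφ⟩ := exists_functional_end (R := R) hE hN
  obtain ⟨n, x, hx⟩ := Module.Finite.exists_fin (R := R) (M := N)
  obtain ⟨m, d', hd'⟩ :=
    Module.Finite.exists_fin (R := R) (M := LinearMap.ker (Fintype.linearCombination R x))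
  let d : Fin m → Fin n → R := fun k => (d' k).1
  have hdx : ∀ k, ∑ i, d k i • x i = 0 := fun k => (d' k).2
  have hd : LinearMap.ker (Fintype.linearCombination R x) ≤ Submodule.span R (Set.range d) := by
    have := congrArg (Submodule.map (LinearMap.ker (Fintype.linearCombination R x)).subtype) hd'
    rw [Submodule.map_span, Submodule.map_subtype_top, ← Set.range_comp] at this
    exact this.ge
  -- extend `φ` to `N ^ n = Hom(R ^ n, N)`
  obtain ⟨ψ, hψ⟩ := exists_comp_eq_of_ker_le hE.injective
    (LinearMap.pi fun i => LinearMap.applyₗ' K (x i) : (N →ₗ[R] N) →ₗ[K] (Fin n → N)) φ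
    fun f hf => by
      have : f = 0 := LinearMap.ext_on_range hx fun i => congrFun hf i
      rw [this, map_zero]
  let M : Submodule R ((Fin m → Coinduced K R E) × N) :=
    { carrier := {p | ∀ i r, ∑ k, p.1 k (d k i * r) = ψ (Pi.single i (r • p.2))}
      zero_mem' := fun i r => by simp
      add_mem' := fun {p q} hp hq i r => by
        simp only [Prod.fst_add, Prod.snd_add, Pi.add_apply, Coinduced.add_apply,
          Finset.sum_add_distrib, smul_add, Pi.single_add, map_add]
        rw [hp i r, hq i r]
      smul_mem' := fun s p hp i r => by
        simp only [Prod.smul_fst, Prod.smul_snd, Pi.smul_apply, Coinduced.smul_apply, mul_assoc,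
          smul_smul]
        exact hp i (r * s) }
  have : Module.Finite K (Coinduced K R E) := inferInstanceAs (Module.Finite K (R →ₗ[K] E))
  have : Module.Finite R (Coinduced K R E) := Module.Finite.of_restrictScalars_finite K R _
  refine ⟨M, inferInstance, inferInstance, LinearMap.snd R _ _ ∘ₗ M.subtype, inferInstance,
    ?_, ?_⟩
  · rintro ⟨s, hs⟩
    have hs2 : ∀ z, (s z).1.2 = z := fun z => LinearMap.congr_fun hs z
    apply hφ1
    rw [← hψ]
    have h1 : (LinearMap.pi fun i => LinearMap.applyₗ' K (x i) : (N →ₗ[R] N) →ₗ[K] (Fin n → N))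
        LinearMap.id = ∑ i, Pi.single i (x i) := by
      rw [Finset.univ_sum_single]
      rfl
    rw [h1, map_sum]
    have h2 : ∀ i, ψ (Pi.single i (x i)) = ∑ k, (s (d k i • x i)).1.1 k 1 := fun i => by
      have := (s (x i)).2 i 1
      rw [one_smul, hs2] at this
      rw [← this]
      refine Finset.sum_congr rfl fun k _ => ?_
      rw [map_smul, Submodule.coe_smul, Prod.smul_fst, Pi.smul_apply, Coinduced.smul_apply, one_mul,
        mul_one]
    simp_rw [h2]
    rw [Finset.sum_comm]
    refine Finset.sum_eq_zero fun k _ => ?_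
    have h3 : ∑ i, (s (d k i • x i)).1.1 k 1 = (s (∑ i, d k i • x i)).1.1 k 1 := by
      rw [map_sum, AddSubmonoidClass.coe_finsetSum, Prod.fst_sum, Finset.sum_apply,
        Coinduced.sum_apply]
    rw [h3, hdx, map_zero]
    rfl
  · intro Y _ _ f hf
    let _ : Module K Y := Module.compHom Y (algebraMap K R)
    have _ : IsScalarTower K R Y := IsScalarTower.of_compHom K R Y
    let δ : (Fin n → Y) →ₗ[K] (Fin m → Y) := LinearMap.pi fun k =>
      ∑ i, (Algebra.lsmul K K Y (d k i)) ∘ₗ LinearMap.proj i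
    have hδ : ∀ y k, δ y k = ∑ i, d k i • y i := fun y k => by simp [δ]
    obtain ⟨l, hl⟩ := exists_comp_eq_of_ker_le hE.injective δ
      (ψ ∘ₗ LinearMap.pi fun i => f.restrictScalars K ∘ₗ LinearMap.proj i) fun y hy => by
        obtain ⟨h, hh⟩ := exists_linearMap_of_relations hx hd (y := y) fun k => by
          rw [← hδ, hy]
          rfl
        have hfh : ¬ Function.Bijective (f ∘ₗ h) := fun hb => hf
          ⟨h ∘ₗ (LinearEquiv.ofBijective (f ∘ₗ h) hb).symm.toLinearMap, LinearMap.ext fun z =>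
            (LinearEquiv.ofBijective (f ∘ₗ h) hb).apply_symm_apply z⟩
        rw [← hφ _ hfh, ← hψ]
        refine congrArg ψ (funext fun i => ?_)
        exact congrArg f (hh i).symm
    have hmem : ∀ y, (LinearMap.pi fun k => Coinduced.lift (R := R)
        (l ∘ₗ LinearMap.single K (fun _ => Y) k)).prod f y ∈ M := by
      intro y i r
      have h1 := hl (Pi.single i (r • y))
      have h2 : δ (Pi.single i (r • y)) = ∑ k, Pi.single k ((d k i * r) • y) := by
        rw [Finset.univ_sum_single]
        refine funext fun k => ?_
        rw [hδ, Finset.sum_eq_single i]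
        · rw [Pi.single_eq_same, smul_smul]
        · intro j _ hj
          rw [Pi.single_eq_of_ne hj, smul_zero]
        · simp
      rw [h2, map_sum] at h1
      refine h1.trans ?_
      refine congrArg ψ (funext fun j => ?_)
      change f ((Pi.single i (r • y) : Fin n → Y) j) = (Pi.single i (r • f y) : Fin n → N) j
      by_cases hj : j = i
      · subst hj
        simp
      · simp [Pi.single_eq_of_ne hj]
    exact ⟨LinearMap.codRestrict M _ hmem, LinearMap.ext fun y => rfl⟩

/-- Existence of left almost split homomorphisms. This is dual to the construction of right almost
split ones: `l` generates the functionals on `N`, `d` generates the relations between them, and by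
reflexivity there is a family `g` in `N` such that `∑ i, l i (h (g i)) = φ h` for all endomorphisms
`h` of `N`. Then `M` is the pushout of `R^n → R^m` along `g : R^n → N`. -/
theorem IsDualizingModule.exists_leftAlmostSplit (hE : IsDualizingModule K E)
    (hN : ∀ e : Module.End R N, IsIdempotentElem e → e = 0 ∨ e = 1) :
    ∃ (M : Type u) (_ : AddCommGroup M) (_ : Module R M) (σ : N →ₗ[R] M), Module.Finite R M ∧
      (¬ ∃ r : M →ₗ[R] N, r ∘ₗ σ = LinearMap.id) ∧
      ∀ (Y : Type u) [AddCommGroup Y] [Module R Y] (f : N →ₗ[R] Y),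
        (¬ ∃ r : Y →ₗ[R] N, r ∘ₗ f = LinearMap.id) → ∃ g : M →ₗ[R] Y, g ∘ₗ σ = f := by
  classical
  let _ : Module K N := Module.compHom N (algebraMap K R)
  have _ : IsScalarTower K R N := IsScalarTower.of_compHom K R N
  have : Module.Finite K N := Module.Finite.trans R N
  have := hE.finite
  have : IsNoetherian R N := isNoetherian_of_tower K inferInstance
  have : IsArtinian R N := isArtinian_of_tower K inferInstance
  obtain ⟨φ, hφ1, hφ⟩ := exists_functional_end (R := R) hE hN
  have hsep : ∀ {M : Type u} [AddCommGroup M] [Module K M] {x y : M},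
      (∀ l : M →ₗ[K] E, l x = l y) → x = y := fun {M} _ _ {x y} h => by
    by_contra hne
    obtain ⟨l, hl⟩ := hE.separates M (x - y) (sub_ne_zero.2 hne)
    exact hl (by rw [map_sub, h, sub_self])
  obtain ⟨n, l, hl⟩ := Module.Finite.exists_fin (R := K) (M := N →ₗ[K] E)
  -- functionals `l i` which agree after precomposition show equality
  have hlsep : ∀ {x y : N}, (∀ i, l i x = l i y) → x = y := fun {x y} h => hsep fun k => by
    have hle : Submodule.span K (Set.range l) ≤
        LinearMap.ker (LinearMap.applyₗ x - LinearMap.applyₗ y) := by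
      rw [Submodule.span_le]
      rintro _ ⟨i, rfl⟩
      simp [h i]
    have := hle (hl ▸ Submodule.mem_top : k ∈ _)
    simpa [sub_eq_zero] using this
  let a : (Fin n → R) →ₗ[K] (N →ₗ[K] E) :=
    { toFun := fun c => ∑ i, l i ∘ₗ Algebra.lsmul K K N (c i)
      map_add' := fun c c' => by
        simp only [Pi.add_apply, map_add, LinearMap.comp_add, Finset.sum_add_distrib]
      map_smul' := fun r c => by
        simp only [Pi.smul_apply, map_smul, LinearMap.comp_smul, Finset.smul_sum,
          RingHom.id_apply] }
  have ha : ∀ c z, a c z = ∑ i, l i (c i • z) := fun c z => by simp [a]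
  obtain ⟨m, d', hd'⟩ := Module.Finite.exists_fin (R := K) (M := LinearMap.ker a)
  let d : Fin m → Fin n → R := fun k => (d' k).1
  have hd0 : ∀ k z, ∑ i, l i (d k i • z) = 0 := fun k z => by
    rw [← ha, LinearMap.mem_ker.1 (d' k).2, LinearMap.zero_apply]
  have hd : LinearMap.ker a ≤ Submodule.span K (Set.range d) := by
    have := congrArg (Submodule.map (LinearMap.ker a).subtype) hd'
    rw [Submodule.map_span, Submodule.map_subtype_top, ← Set.range_comp] at this
    exact this.ge
  -- functionals `μ` on `Y` satisfying the relations `d` come from homomorphisms `h : Y → N`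
  have hrep : ∀ (Y : Type u) [AddCommGroup Y] [Module R Y] [Module K Y] [IsScalarTower K R Y]
      (μ : Fin n → Y →ₗ[K] E), (∀ k y, ∑ i, μ i (d k i • y) = 0) →
      ∃ h : Y →ₗ[R] N, ∀ i y, μ i y = l i (h y) := by
    intro Y _ _ _ _ μ hμ
    let b : Y → (Fin n → R) →ₗ[K] E := fun y =>
      ∑ i, μ i ∘ₗ (LinearMap.toSpanSingleton R Y y).restrictScalars K ∘ₗ LinearMap.proj i
    have hb : ∀ y c, b y c = ∑ i, μ i (c i • y) := fun y c => by simp [b]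
    have hex : ∀ y, ∃ z : N, ∀ c : Fin n → R, ∑ i, μ i (c i • y) = ∑ i, l i (c i • z) := by
      intro y
      have hle : LinearMap.ker a ≤ LinearMap.ker (b y) := by
        refine hd.trans (Submodule.span_le.2 ?_)
        rintro _ ⟨k, rfl⟩
        exact (hb y _).trans (hμ k y)
      obtain ⟨Φ, hΦ⟩ := exists_comp_eq_of_ker_le hE.injective a (b y) fun c hc => hle hc
      obtain ⟨z, hz⟩ := hE.eval_surjective N Φ
      exact ⟨z, fun c => by rw [← hb, ← hΦ, hz, ha]⟩
    choose h hh using hex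
    have hh1 : ∀ i y r, μ i (r • y) = l i (r • h y) := fun i y r => by
      have := hh y (Pi.single i r)
      rw [Fintype.sum_eq_single i fun j hj => by rw [Pi.single_eq_of_ne hj, zero_smul, map_zero],
        Fintype.sum_eq_single i fun j hj => by rw [Pi.single_eq_of_ne hj, zero_smul, map_zero],
        Pi.single_eq_same] at this
      exact this
    refine ⟨⟨⟨h, fun y y' => hlsep fun i => ?_⟩, fun r y => hlsep fun i => ?_⟩, fun i y => ?_⟩
    · have h1 := hh1 i (y + y') 1
      have h2 := hh1 i y 1
      have h3 := hh1 i y' 1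
      rw [one_smul, one_smul] at h1 h2 h3
      rw [map_add, ← h1, ← h2, ← h3, map_add]
    · have h1 := hh1 i (r • y) 1
      rw [one_smul, one_smul] at h1
      rw [RingHom.id_apply, ← hh1, ← h1]
    · simpa using hh1 i y 1
  obtain ⟨g, hg⟩ : ∃ g : Fin n → N, ∀ h : N →ₗ[R] N, ∑ i, l i (h (g i)) = φ h := by
    let α : (N →ₗ[R] N) →ₗ[K] ((Fin n → N) →ₗ[K] E) :=
      { toFun := fun h => ∑ i, l i ∘ₗ h.restrictScalars K ∘ₗ LinearMap.proj i
        map_add' := fun h h' => by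
          ext
          simp [Finset.sum_add_distrib]
        map_smul' := fun r h => by
          ext
          simp [Finset.smul_sum] }
    have hα : ∀ h v, α h v = ∑ i, l i (h (v i)) := fun h v => by simp [α]
    obtain ⟨Φ, hΦ⟩ := exists_comp_eq_of_ker_le hE.injective α φ fun h h0 => by
      have : h = 0 := LinearMap.ext fun z => hlsep fun i => by
        have := LinearMap.congr_fun h0 (Pi.single i z)
        rw [hα, Fintype.sum_eq_single i fun j hj => by
          rw [Pi.single_eq_of_ne hj, map_zero, map_zero], Pi.single_eq_same] at this
        rw [this, LinearMap.zero_apply, LinearMap.zero_apply, map_zero]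
      rw [this, map_zero]
    obtain ⟨g, hg⟩ := hE.eval_surjective (Fin n → N) Φ
    exact ⟨g, fun h => by rw [← hα, ← hg, hΦ]⟩
  let β : (Fin n → R) →ₗ[R] N × (Fin m → R) :=
    Fintype.linearCombination R fun i => (g i, fun k => -d k i)
  have hβ : ∀ i, (g i, (0 : Fin m → R)) - (0, fun k => d k i) ∈ LinearMap.range β := fun i =>
    ⟨Pi.single i 1, by simp [β]; rfl⟩
  let S := LinearMap.range β
  refine ⟨(N × (Fin m → R)) ⧸ S, inferInstance, inferInstance, S.mkQ ∘ₗ LinearMap.inl R N _,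
    inferInstance, ?_, ?_⟩
  · rintro ⟨r, hr⟩
    have hr1 : ∀ z, r (S.mkQ (z, 0)) = z := fun z => LinearMap.congr_fun hr z
    apply hφ1
    rw [← hg]
    have h1 : ∀ i, g i = ∑ k, d k i • r (S.mkQ (0, Pi.single k 1)) := fun i => by
      have h2 := (Submodule.Quotient.mk_eq_zero S).2 (hβ i)
      rw [← Submodule.mkQ_apply, map_sub, sub_eq_zero] at h2
      rw [← hr1 (g i), h2]
      have h3 : ((0, fun k => d k i) : N × (Fin m → R)) =
          ∑ k, d k i • ((0, Pi.single k 1) : N × (Fin m → R)) := by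
        refine Prod.ext (by simp [Prod.fst_sum]) (funext fun k => ?_)
        simp [Prod.snd_sum, Finset.sum_apply, Pi.single_apply]
      rw [h3]
      simp only [map_sum, map_smul]
    have h2 : ∀ i, l i (LinearMap.id (R := R) (g i)) =
        ∑ k, l i (d k i • r (S.mkQ (0, Pi.single k 1))) := fun i => by
      rw [LinearMap.id_apply]
      conv_lhs => rw [h1 i]
      exact map_sum _ _ _
    simp_rw [h2]
    rw [Finset.sum_comm]
    exact Finset.sum_eq_zero fun k _ => hd0 k _
  · intro Y _ _ f hf
    let _ : Module K Y := Module.compHom Y (algebraMap K R)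
    have _ : IsScalarTower K R Y := IsScalarTower.of_compHom K R Y
    let δ : (Fin m → Y) →ₗ[K] (Fin n → Y) := LinearMap.pi fun i =>
      ∑ k, (Algebra.lsmul K K Y (d k i)) ∘ₗ LinearMap.proj k
    have hδ : ∀ y i, δ y i = ∑ k, d k i • y k := fun y i => by simp [δ]
    obtain ⟨y, hy⟩ : (fun i => f (g i)) ∈ LinearMap.range δ := by
      rw [← Submodule.Quotient.mk_eq_zero, ← Submodule.mkQ_apply]
      refine hsep fun μ => ?_
      rw [map_zero]
      let μ' : Fin n → Y →ₗ[K] E := fun i =>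
        μ ∘ₗ (LinearMap.range δ).mkQ ∘ₗ LinearMap.single K (fun _ => Y) i
      obtain ⟨h, hh⟩ := hrep Y μ' fun k y => by
        have h1 : ∑ i, LinearMap.single K (fun _ => Y) i (d k i • y) = δ (Pi.single k y) := by
          refine (Finset.univ_sum_single _).trans (funext fun i => ?_)
          rw [hδ, Fintype.sum_eq_single k fun j hj => by rw [Pi.single_eq_of_ne hj, smul_zero],
            Pi.single_eq_same]
        have h2 : (LinearMap.range δ).mkQ (δ (Pi.single k y)) = 0 :=
          (Submodule.Quotient.mk_eq_zero _).2 ⟨_, rfl⟩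
        simp only [μ', LinearMap.comp_apply, ← map_sum]
        rw [h1, h2, map_zero]
      have hhf : ¬ Function.Bijective (h ∘ₗ f) := fun hb => hf
        ⟨(LinearEquiv.ofBijective (h ∘ₗ f) hb).symm.toLinearMap ∘ₗ h, LinearMap.ext fun z =>
          (LinearEquiv.ofBijective (h ∘ₗ f) hb).symm_apply_apply z⟩
      rw [← hφ _ hhf, ← hg, ← Finset.univ_sum_single fun i => f (g i), map_sum, map_sum]
      exact Finset.sum_congr rfl fun i _ => hh i (f (g i))
    let q : N × (Fin m → R) →ₗ[R] Y := f.coprod (Fintype.linearCombination R y)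
    have hq : S ≤ LinearMap.ker q := by
      rintro _ ⟨c, rfl⟩
      rw [Fintype.linearCombination_apply, LinearMap.mem_ker, map_sum]
      refine Finset.sum_eq_zero fun i _ => ?_
      rw [map_smul]
      have : q (g i, fun k => -d k i) = 0 := by
        have h1 := congrFun hy i
        rw [hδ] at h1
        simp [q, Fintype.linearCombination_apply, ← h1]
      rw [this, smul_zero]
    refine ⟨S.liftQ q hq, LinearMap.ext fun z => ?_⟩
    simp [q]

end AlmostSplitModules

/-! ### The category of modules over an artin algebra -/

section ModuleCategory

open Limits

variable {R : Type u} [Ring R]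

lemma ModuleCat.isSplitEpi_iff {X Y : ModuleCat.{u} R} (f : X ⟶ Y) :
    IsSplitEpi f ↔ ∃ s : Y →ₗ[R] X, f.hom ∘ₗ s = LinearMap.id :=
  ⟨fun ⟨⟨s⟩⟩ => ⟨s.section_.hom, ModuleCat.hom_ext_iff.1 s.id⟩,
    fun ⟨s, hs⟩ => ⟨⟨⟨ModuleCat.ofHom s, ModuleCat.hom_ext hs⟩⟩⟩⟩

lemma ModuleCat.isSplitMono_iff {X Y : ModuleCat.{u} R} (f : X ⟶ Y) :
    IsSplitMono f ↔ ∃ s : Y →ₗ[R] X, s ∘ₗ f.hom = LinearMap.id :=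
  ⟨fun ⟨⟨s⟩⟩ => ⟨s.retraction.hom, ModuleCat.hom_ext_iff.1 s.id⟩,
    fun ⟨s, hs⟩ => ⟨⟨⟨ModuleCat.ofHom s, ModuleCat.hom_ext hs⟩⟩⟩⟩

lemma IsIdempotentFree.nontrivial {X : ModuleCat.{u} R} (h : IsIdempotentFree X) :
    Nontrivial X := by
  rw [← not_subsingleton_iff_nontrivial, ← ModuleCat.isZero_iff_subsingleton]
  exact h.1

lemma IsIdempotentFree.end_eq {X : ModuleCat.{u} R} (h : IsIdempotentFree X)
    (e : Module.End R X) (he : IsIdempotentElem e) : e = 0 ∨ e = 1 :=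
  (h.2 (ModuleCat.ofHom e) (ModuleCat.hom_ext he)).imp (fun h => ModuleCat.hom_ext_iff.1 h)
    fun h => ModuleCat.hom_ext_iff.1 h

lemma IsFiniteSum.of_retracts {𝒜 : Type*} [Category 𝒜] [Preadditive 𝒜] {C : 𝒜 → Prop}
    {X Y Z : 𝒜} (r : Retract X Z) (s : Retract Y Z) (hrs : r.i ≫ s.r = 0) (hsr : s.i ≫ r.r = 0)
    (hsum : r.r ≫ r.i + s.r ≫ s.i = 𝟙 Z) (hX : IsFiniteSum C X) (hY : IsFiniteSum C Y) :
    IsFiniteSum C Z := by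
  obtain ⟨ι, _, U, i, p, hU, h1, h0, hs⟩ := hX
  obtain ⟨ι', _, V, j, q, hV, h1', h0', hs'⟩ := hY
  refine ⟨ι ⊕ ι', inferInstance, Sum.elim U V,
    fun | .inl a => i a ≫ r.i | .inr a => j a ≫ s.i,
    fun | .inl a => r.r ≫ p a | .inr a => s.r ≫ q a, ?_, ?_, ?_, ?_⟩
  · rintro (a | a)
    exacts [hU a, hV a]
  · rintro (a | a)
    · simp [h1]
    · simp [h1']
  · rintro (a | a) (b | b) hab
    · change (i a ≫ r.i) ≫ r.r ≫ p b = 0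
      rw [Category.assoc, r.retract_assoc, h0 a b fun h => hab (congrArg _ h)]
    · change (i a ≫ r.i) ≫ s.r ≫ q b = 0
      rw [Category.assoc, reassoc_of% hrs, zero_comp, comp_zero]
    · change (j a ≫ s.i) ≫ r.r ≫ p b = 0
      rw [Category.assoc, reassoc_of% hsr, zero_comp, comp_zero]
    · change (j a ≫ s.i) ≫ s.r ≫ q b = 0
      rw [Category.assoc, s.retract_assoc, h0' a b fun h => hab (congrArg _ h)]
  · rw [Fintype.sum_sum_type, ← hsum]
    congr 1
    · conv_rhs => rw [← Category.id_comp r.i, ← hs, Preadditive.sum_comp, Preadditive.comp_sum]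
      simp
    · conv_rhs => rw [← Category.id_comp s.i, ← hs', Preadditive.sum_comp, Preadditive.comp_sum]
      simp

lemma IsFiniteSum.of_isZero {𝒜 : Type*} [Category 𝒜] [Preadditive 𝒜] {C : 𝒜 → Prop}
    {X : 𝒜} (hX : IsZero X) : IsFiniteSum C X :=
  ⟨Empty, inferInstance, fun a => a.elim, fun a => a.elim, fun a => a.elim, fun a => a.elim,
    fun a => a.elim, fun a => a.elim, hX.eq_of_src _ _⟩

lemma IsFiniteSum.single {𝒜 : Type*} [Category 𝒜] [Preadditive 𝒜] {C : 𝒜 → Prop}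
    {X : 𝒜} (hX : C X) : IsFiniteSum C X :=
  ⟨Unit, inferInstance, fun _ => X, fun _ => 𝟙 X, fun _ => 𝟙 X, fun _ => hX, fun _ => by simp,
    fun a b h => (h rfl).elim, by simp⟩

/-- Every finitely generated module over an artinian ring is a finite direct sum of
indecomposables. -/
lemma ModuleCat.isFiniteSum [IsArtinianRing R] (X : ModuleCat.{u} R)
    (hX : Module.Finite R X) :
    IsFiniteSum (fun Y : ModuleCat.{u} R => Module.Finite R Y ∧ IsIdempotentFree Y) X := by
  suffices H : ∀ (n : ℕ∞) (X : ModuleCat.{u} R), Module.Finite R X → Module.length R X = n →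
      IsFiniteSum (fun Y : ModuleCat.{u} R => Module.Finite R Y ∧ IsIdempotentFree Y) X from
    H _ X hX rfl
  intro n
  induction n using WellFoundedLT.induction with
  | ind n ih =>
    intro X hX hn
    by_cases hz : IsZero X
    · exact .of_isZero hz
    by_cases hi : IsIdempotentFree X
    · exact .single ⟨hX, hi⟩
    have : ∃ e : X ⟶ X, e ≫ e = e ∧ e ≠ 0 ∧ e ≠ 𝟙 X := by
      by_contra! h
      exact hi ⟨hz, fun e he => or_iff_not_imp_left.2 (h e he)⟩
    obtain ⟨e, he, he0, he1⟩ := this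
    -- a submodule which is the image of an idempotent `f ≠ 1`
    have key : ∀ f : X ⟶ X, f ≫ f = f → f ≠ 𝟙 X → IsFiniteSum
        (fun Y : ModuleCat.{u} R => Module.Finite R Y ∧ IsIdempotentFree Y)
        (ModuleCat.of R (LinearMap.range f.hom)) := fun f hf hf1 => by
      refine ih (Module.length R (LinearMap.range f.hom)) ?_ _ inferInstance rfl
      rw [← hn]
      refine Submodule.length_lt fun htop => hf1 ?_
      have : Epi f := (ModuleCat.epi_iff_range_eq_top f).2 htop
      rw [← cancel_epi f, hf, Category.comp_id]
    let ret : ∀ f : X ⟶ X, f ≫ f = f → Retract (ModuleCat.of R (LinearMap.range f.hom)) X :=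
      fun f hf => ⟨ModuleCat.ofHom (LinearMap.range f.hom).subtype,
        ModuleCat.ofHom f.hom.rangeRestrict, by
          ext ⟨_, x, rfl⟩
          exact congrArg (fun g : X ⟶ X => g x) hf⟩
    have hret : ∀ f hf, (ret f hf).r ≫ (ret f hf).i = f := fun f hf => rfl
    have he' : (𝟙 X - e) ≫ (𝟙 X - e) = 𝟙 X - e := by
      simp [Preadditive.sub_comp, Preadditive.comp_sub, he]
    have hir : ∀ f hf, f ≫ (ret f hf).r = (ret f hf).r := fun f hf => by
      have : Mono (ret f hf).i := mono_of_mono_fac (ret f hf).retract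
      rw [← cancel_mono (ret f hf).i, Category.assoc, hret f hf, hf]
    have hii : ∀ f hf, (ret f hf).i ≫ f = (ret f hf).i := fun f hf => by
      calc (ret f hf).i ≫ f = (ret f hf).i ≫ (ret f hf).r ≫ (ret f hf).i := by rw [hret f hf]
        _ = (ret f hf).i := (ret f hf).retract_assoc _
    refine IsFiniteSum.of_retracts (ret e he) (ret (𝟙 X - e) he') ?_ ?_ ?_ (key e he he1)
      (key (𝟙 X - e) he' fun h => he0 (by simpa using h))
    · rw [← hii e he, ← hir _ he']
      simp [Preadditive.comp_sub, Preadditive.sub_comp, reassoc_of% he]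
    · rw [← hii _ he', ← hir e he]
      simp [Preadditive.comp_sub, Preadditive.sub_comp, reassoc_of% he]
    · rw [hret e he, hret _ he']
      abel

/-- The finitely generated modules over an artin algebra form a length class. -/
lemma isLengthClass_finite (K R : Type u) [CommRing K] [IsArtinianRing K] [Ring R] [Algebra K R]
    [Module.Finite K R] : IsLengthClass (fun X : ModuleCat.{u} R => Module.Finite R X) where
  of_mono f _ h := by
    have : IsNoetherianRing R := isNoetherian_of_tower K inferInstance
    exact Module.Finite.of_injective f.hom ((ModuleCat.mono_iff_injective f).1 ‹_›)
  of_epi f _ h := Module.Finite.of_surjective f.hom ((ModuleCat.epi_iff_surjective f).1 ‹_›)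
  of_shortExact S hS h1 h3 := by
    have : IsNoetherianRing R := isNoetherian_of_tower K inferInstance
    have := isNoetherian_of_range_eq_ker S.f.hom S.g.hom
      ((ShortComplex.moduleCat_exact_iff_range_eq_ker S).1 hS.exact)
    infer_instance
  isFiniteSum X hX := by
    have : IsArtinianRing R := isArtinian_of_tower K inferInstance
    exact X.isFiniteSum hX
  enoughProjectives X hX := by
    obtain ⟨n, f, hf⟩ := Module.Finite.exists_fin' R X
    refine ⟨ModuleCat.of R (Fin n → R), ModuleCat.ofHom f, inferInstanceAs
      (Module.Finite R (Fin n → R)), ?_, (ModuleCat.epi_iff_surjective _).2 hf⟩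
    exact (IsProjective.iff_projective (R := R) (Fin n → R)).1 inferInstance
  enoughInjectives X hX := by
    obtain ⟨E, _, _, hE⟩ := exists_isDualizingModule K
    obtain ⟨J, _, _, i, h1, h2, h3⟩ := hE.exists_injective (R := R) X
    exact ⟨ModuleCat.of R J, ModuleCat.ofHom i, h1,
      Module.injective_object_of_injective_module R J, (ModuleCat.mono_iff_injective _).2 h3⟩

/-- Existence of minimal right almost split maps: a right almost split map with source of minimal
length is right minimal. -/
lemma exists_rightAlmostSplit_minimal (K : Type u) [CommRing K] [IsArtinianRing K] [Algebra K R]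
    [Module.Finite K R] (X : ModuleCat.{u} R) (hX : Module.Finite R X)
    (hXi : IsIdempotentFree X) : ∃ (E : ModuleCat.{u} R) (π : E ⟶ X), Module.Finite R E ∧
      IsRightAlmostSplit (fun Y : ModuleCat.{u} R => Module.Finite R Y) π ∧ IsRightMinimal π := by
  obtain ⟨D, _, _, hD⟩ := exists_isDualizingModule K
  have := hXi.nontrivial
  have : IsNoetherianRing R := isNoetherian_of_tower K inferInstance
  have : IsArtinianRing R := isArtinian_of_tower K inferInstance
  let s : Set ℕ∞ := {n | ∃ (E : ModuleCat.{u} R) (π : E ⟶ X), Module.length R E = n ∧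
    Module.Finite R E ∧ IsRightAlmostSplit (fun Y : ModuleCat.{u} R => Module.Finite R Y) π}
  have hs : s.Nonempty := by
    obtain ⟨M, _, _, π, hM, h1, h2⟩ := hD.exists_rightAlmostSplit (N := X) hXi.end_eq
    refine ⟨_, ModuleCat.of R M, ModuleCat.ofHom π, rfl, hM,
      fun h => h1 ((ModuleCat.isSplitEpi_iff _).1 h), fun Y f _ hf => ?_⟩
    obtain ⟨g, hg⟩ := h2 Y f.hom fun h => hf ((ModuleCat.isSplitEpi_iff _).2 h)
    exact ⟨ModuleCat.ofHom g, ModuleCat.hom_ext hg⟩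
  obtain ⟨E, π, hlen, hE, hπ⟩ := WellFounded.min_mem wellFounded_lt s hs
  refine ⟨E, π, hE, hπ, fun φ hφ => ?_⟩
  have hsurj : LinearMap.range φ.hom = ⊤ := by
    by_contra hne
    refine WellFounded.not_lt_min wellFounded_lt s (x := Module.length R (LinearMap.range φ.hom))
      ?_ (hlen ▸ Submodule.length_lt hne)
    let i : ModuleCat.of R (LinearMap.range φ.hom) ⟶ E := ModuleCat.ofHom (Submodule.subtype _)
    let r : E ⟶ ModuleCat.of R (LinearMap.range φ.hom) := ModuleCat.ofHom φ.hom.rangeRestrict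
    have hri : r ≫ i = φ := rfl
    refine ⟨_, i ≫ π, rfl, inferInstanceAs (Module.Finite R (LinearMap.range φ.hom)), ?_, ?_⟩
    · rintro ⟨⟨s⟩⟩
      exact hπ.1 ⟨⟨⟨s.section_ ≫ i, by rw [Category.assoc, s.id]⟩⟩⟩
    · intro Y f hY hf
      obtain ⟨g, hg⟩ := hπ.2 Y f hY hf
      exact ⟨g ≫ r, by rw [Category.assoc, reassoc_of% hri, hφ, hg]⟩
  rw [ConcreteCategory.isIso_iff_bijective]
  exact IsNoetherian.bijective_of_surjective_endomorphism φ.hom (LinearMap.range_eq_top.1 hsurj)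

/-- Existence of minimal left almost split maps. -/
lemma exists_leftAlmostSplit_minimal (K : Type u) [CommRing K] [IsArtinianRing K] [Algebra K R]
    [Module.Finite K R] (X : ModuleCat.{u} R) (hX : Module.Finite R X)
    (hXi : IsIdempotentFree X) : ∃ (E : ModuleCat.{u} R) (σ : X ⟶ E), Module.Finite R E ∧
      IsLeftAlmostSplit (fun Y : ModuleCat.{u} R => Module.Finite R Y) σ ∧ IsLeftMinimal σ := by
  obtain ⟨D, _, _, hD⟩ := exists_isDualizingModule K
  have := hXi.nontrivial
  have : IsNoetherianRing R := isNoetherian_of_tower K inferInstance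
  have : IsArtinianRing R := isArtinian_of_tower K inferInstance
  let s : Set ℕ∞ := {n | ∃ (E : ModuleCat.{u} R) (σ : X ⟶ E), Module.length R E = n ∧
    Module.Finite R E ∧ IsLeftAlmostSplit (fun Y : ModuleCat.{u} R => Module.Finite R Y) σ}
  have hs : s.Nonempty := by
    obtain ⟨M, _, _, σ, hM, h1, h2⟩ := hD.exists_leftAlmostSplit (N := X) hXi.end_eq
    refine ⟨_, ModuleCat.of R M, ModuleCat.ofHom σ, rfl, hM,
      fun h => h1 ((ModuleCat.isSplitMono_iff _).1 h), fun Y f _ hf => ?_⟩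
    obtain ⟨g, hg⟩ := h2 Y f.hom fun h => hf ((ModuleCat.isSplitMono_iff _).2 h)
    exact ⟨ModuleCat.ofHom g, ModuleCat.hom_ext hg⟩
  obtain ⟨E, σ, hlen, hE, hσ⟩ := WellFounded.min_mem wellFounded_lt s hs
  refine ⟨E, σ, hE, hσ, fun φ hφ => ?_⟩
  have hsurj : LinearMap.range φ.hom = ⊤ := by
    by_contra hne
    refine WellFounded.not_lt_min wellFounded_lt s (x := Module.length R (LinearMap.range φ.hom))
      ?_ (hlen ▸ Submodule.length_lt hne)
    let i : ModuleCat.of R (LinearMap.range φ.hom) ⟶ E := ModuleCat.ofHom (Submodule.subtype _)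
    let r : E ⟶ ModuleCat.of R (LinearMap.range φ.hom) := ModuleCat.ofHom φ.hom.rangeRestrict
    have hri : r ≫ i = φ := rfl
    refine ⟨_, σ ≫ r, rfl, inferInstanceAs (Module.Finite R (LinearMap.range φ.hom)), ?_, ?_⟩
    · rintro ⟨⟨s⟩⟩
      exact hσ.1 ⟨⟨⟨r ≫ s.retraction, by rw [← Category.assoc, s.id]⟩⟩⟩
    · intro Y f hY hf
      obtain ⟨g, hg⟩ := hσ.2 Y f hY hf
      exact ⟨i ≫ g, by rw [Category.assoc, reassoc_of% hri, reassoc_of% hφ, hg]⟩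
  rw [ConcreteCategory.isIso_iff_bijective]
  exact IsNoetherian.bijective_of_surjective_endomorphism φ.hom (LinearMap.range_eq_top.1 hsurj)

end ModuleCategory

/-! ### Irreducible homomorphisms -/

section Irreducible

open Limits

variable {R : Type u} [Ring R]

/-- The restriction of a minimal right almost split map to a non-zero direct summand of its source
is irreducible. -/
lemma isIrreducibleHom_of_rightAlmostSplit {E X Y : ModuleCat.{u} R} {π : E ⟶ X}
    (hπ : IsRightAlmostSplit (fun Y : ModuleCat.{u} R => Module.Finite R Y) π)
    (hmin : IsRightMinimal π) (hX : IsIdempotentFree X) (hY : ¬ IsZero Y) (r : Retract Y E) :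
    IsIrreducibleHom (r.i ≫ π) := by
  have hepi : ¬ IsSplitEpi (r.i ≫ π) := fun ⟨⟨s⟩⟩ =>
    hπ.1 ⟨⟨⟨s.section_ ≫ r.i, by rw [Category.assoc, s.id]⟩⟩⟩
  refine ⟨fun ⟨⟨s⟩⟩ => hepi ⟨⟨⟨s.retraction, hX.comp_eq_id hY _ _ s.id⟩⟩⟩, hepi, ?_⟩
  intro Z hZ g h hgh
  by_cases hsplit : IsSplitEpi h
  · exact Or.inr hsplit
  left
  obtain ⟨s, hs⟩ := hπ.2 Z h hZ hsplit
  have hφ : (r.r ≫ g ≫ s + (𝟙 E - r.r ≫ r.i)) ≫ π = π := by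
    simp [Preadditive.add_comp, Preadditive.sub_comp, hs, hgh]
  have := hmin _ hφ
  have hi : r.i ≫ (r.r ≫ g ≫ s + (𝟙 E - r.r ≫ r.i)) = g ≫ s := by
    simp [Preadditive.comp_add, Preadditive.comp_sub]
  generalize r.r ≫ g ≫ s + (𝟙 E - r.r ≫ r.i) = φ at *
  refine ⟨⟨⟨s ≫ inv φ ≫ r.r, ?_⟩⟩⟩
  rw [← Category.assoc, ← hi, Category.assoc, IsIso.hom_inv_id_assoc, r.retract]

/-- The corestriction of a minimal left almost split map to a non-zero direct summand of its target
is irreducible. -/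
lemma isIrreducibleHom_of_leftAlmostSplit {E X Y : ModuleCat.{u} R} {σ : X ⟶ E}
    (hσ : IsLeftAlmostSplit (fun Y : ModuleCat.{u} R => Module.Finite R Y) σ)
    (hmin : IsLeftMinimal σ) (hX : IsIdempotentFree X) (hY : ¬ IsZero Y) (r : Retract Y E) :
    IsIrreducibleHom (σ ≫ r.r) := by
  have hmono : ¬ IsSplitMono (σ ≫ r.r) := fun ⟨⟨s⟩⟩ =>
    hσ.1 ⟨⟨⟨r.r ≫ s.retraction, by rw [← Category.assoc, s.id]⟩⟩⟩
  refine ⟨hmono, fun ⟨⟨s⟩⟩ => hmono ⟨⟨⟨s.section_, hX.comp_eq_id hY _ _ s.id⟩⟩⟩, ?_⟩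
  intro Z hZ g h hgh
  by_cases hsplit : IsSplitMono g
  · exact Or.inl hsplit
  right
  obtain ⟨s, hs⟩ := hσ.2 Z g hZ hsplit
  have hφ : σ ≫ (s ≫ h ≫ r.i + (𝟙 E - r.r ≫ r.i)) = σ := by
    simp [Preadditive.comp_add, Preadditive.comp_sub, reassoc_of% hs, reassoc_of% hgh]
  have := hmin _ hφ
  have hr : (s ≫ h ≫ r.i + (𝟙 E - r.r ≫ r.i)) ≫ r.r = s ≫ h := by
    simp [Preadditive.add_comp, Preadditive.sub_comp]
  generalize s ≫ h ≫ r.i + (𝟙 E - r.r ≫ r.i) = φ at *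
  refine ⟨⟨⟨r.i ≫ inv φ ≫ s, ?_⟩⟩⟩
  rw [Category.assoc, Category.assoc, ← hr, IsIso.inv_hom_id_assoc, r.retract]

/-- An irreducible homomorphism with non-zero source is non-zero, since otherwise it would factor
through the zero module. -/
lemma IsIrreducibleHom.ne_zero {X Y : ModuleCat.{u} R} {f : X ⟶ Y} (hf : IsIrreducibleHom f)
    (hX : ¬ IsZero X) (hY : ¬ IsZero Y) : f ≠ 0 := by
  rintro rfl
  have hz : IsZero (ModuleCat.of R PUnit.{u + 1}) := ModuleCat.isZero_of_subsingleton _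
  rcases hf.2.2 (ModuleCat.of R PUnit) (inferInstanceAs (Module.Finite R PUnit.{u + 1})) 0 0
    (by simp) with h | h
  · obtain ⟨⟨s⟩⟩ := h
    exact hX ((IsZero.iff_id_eq_zero X).2 (by rw [← s.id, zero_comp]))
  · obtain ⟨⟨s⟩⟩ := h
    exact hY ((IsZero.iff_id_eq_zero Y).2 (by rw [← s.id, comp_zero]))

end Irreducible

/-! ### Components of the Auslander-Reiten quiver -/

section Component

open Limits

variable {R : Type u} [Ring R]

lemma IsIdempotentFree.of_iso {𝒜 : Type*} [Category 𝒜] [Preadditive 𝒜] {X Y : 𝒜}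
    (h : IsIdempotentFree X) (e : X ≅ Y) : IsIdempotentFree Y := by
  refine ⟨fun hY => h.1 (hY.of_iso e), fun f hf => ?_⟩
  refine (h.2 (e.hom ≫ f ≫ e.inv) (by simp [reassoc_of% hf])).imp (fun h0 => ?_) fun h1 => ?_
  · rw [← cancel_epi e.hom, ← cancel_mono e.inv, Category.assoc, h0]
    simp
  · rw [← cancel_epi e.hom, ← cancel_mono e.inv, Category.assoc, h1]
    simp

lemma isFGIndecomposable_iff {X : ModuleCat.{u} R} :
    IsFGIndecomposable X ↔ Module.Finite R X ∧ IsIdempotentFree X :=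
  and_congr_right fun _ => indecomposable_iff_isIdempotentFree X

lemma IsFGIndecomposable.of_iso {X Y : ModuleCat.{u} R} (h : IsFGIndecomposable X) (e : X ≅ Y) :
    IsFGIndecomposable Y := by
  rw [isFGIndecomposable_iff] at h ⊢
  have := h.1
  exact ⟨Module.Finite.equiv e.toLinearEquiv, h.2.of_iso e⟩

namespace IsARComponent

variable {C : Set (ModuleCat.{u} R)}

lemma mem_of_step (hC : IsARComponent C) {X Y : ModuleCat.{u} R} (h : ARStep X Y) :
    X ∈ C ↔ Y ∈ C := by
  obtain ⟨W, _, rfl⟩ := hC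
  exact ⟨fun hX => hX.trans _ _ _ (.rel _ _ h),
    fun hY => hY.trans _ _ _ ((Relation.EqvGen.rel _ _ h).symm)⟩

lemma isFGIndecomposable (hC : IsARComponent C) {X : ModuleCat.{u} R} (hX : X ∈ C) :
    IsFGIndecomposable X := by
  obtain ⟨W, hW, rfl⟩ := hC
  have key : ∀ {Y Z : ModuleCat.{u} R}, Relation.EqvGen ARStep Y Z →
      (IsFGIndecomposable Y ↔ IsFGIndecomposable Z) := fun h => by
    induction h with
    | rel Y Z h => exact iff_of_true h.1 h.2.1
    | refl Y => exact Iff.rfl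
    | symm Y Z _ ih => exact ih.symm
    | trans Y Z V _ _ ih ih' => exact ih.trans ih'
  exact (key hX).1 hW

lemma isIdempotentFree (hC : IsARComponent C) {X : ModuleCat.{u} R} (hX : X ∈ C) :
    IsIdempotentFree X :=
  (isFGIndecomposable_iff.1 (hC.isFGIndecomposable hX)).2

lemma mem_of_iso (hC : IsARComponent C) {X Y : ModuleCat.{u} R} (hX : X ∈ C) (e : X ≅ Y) : Y ∈ C :=
  have hXi := hC.isFGIndecomposable hX
  (hC.mem_of_step ⟨hXi, hXi.of_iso e, Or.inl ⟨e⟩⟩).1 hX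

/-- A property of modules in `C` which is inherited along isomorphisms and irreducible
homomorphisms in both directions holds for all modules in `C` if it holds for one of them. -/
lemma induction (hC : IsARComponent C) {p : ModuleCat.{u} R → Prop} {X : ModuleCat.{u} R}
    (hX : X ∈ C) (hpX : p X)
    (h : ∀ Y Z, ARStep Y Z → (p Y ↔ p Z)) {Y : ModuleCat.{u} R} (hY : Y ∈ C) : p Y := by
  obtain ⟨W, hW, rfl⟩ := hC
  have key : ∀ {Y Z : ModuleCat.{u} R}, Relation.EqvGen ARStep Y Z → (p Y ↔ p Z) := fun h' => by
    induction h' with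
    | rel Y Z h' => exact h Y Z h'
    | refl Y => exact Iff.rfl
    | symm Y Z _ ih => exact ih.symm
    | trans Y Z V _ _ ih ih' => exact ih.trans ih'
  exact (key hY).1 ((key hX).2 hpX)

/-- The source of the minimal right almost split map ending at a module in `C` is a direct sum of
modules in `C`. -/
lemma exists_rightAlmostSplit (hC : IsARComponent C) (K : Type u) [CommRing K] [IsArtinianRing K]
    [Algebra K R] [Module.Finite K R] {X : ModuleCat.{u} R} (hX : X ∈ C) :
    ∃ (E : ModuleCat.{u} R) (π : E ⟶ X), IsFiniteSum (· ∈ C) E ∧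
      IsRightAlmostSplit (fun Y : ModuleCat.{u} R => Module.Finite R Y) π := by
  obtain ⟨hX1, hX2⟩ := isFGIndecomposable_iff.1 (hC.isFGIndecomposable hX)
  obtain ⟨E, π, hE, hπ, hmin⟩ := exists_rightAlmostSplit_minimal K X hX1 hX2
  obtain ⟨ι, _, Y, i, p, hY, h1, h0, hs⟩ := (isLengthClass_finite K R).isFiniteSum E hE
  refine ⟨E, π, ⟨ι, inferInstance, Y, i, p, fun j => ?_, h1, h0, hs⟩, hπ⟩
  exact (hC.mem_of_step ⟨isFGIndecomposable_iff.2 (hY j), hC.isFGIndecomposable hX, Or.inr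
    ⟨_, isIrreducibleHom_of_rightAlmostSplit hπ hmin hX2 (hY j).2.1 ⟨i j, p j, h1 j⟩⟩⟩).2 hX

lemma exists_leftAlmostSplit (hC : IsARComponent C) (K : Type u) [CommRing K] [IsArtinianRing K]
    [Algebra K R] [Module.Finite K R] {X : ModuleCat.{u} R} (hX : X ∈ C) :
    ∃ (E : ModuleCat.{u} R) (σ : X ⟶ E), IsFiniteSum (· ∈ C) E ∧
      IsLeftAlmostSplit (fun Y : ModuleCat.{u} R => Module.Finite R Y) σ := by
  obtain ⟨hX1, hX2⟩ := isFGIndecomposable_iff.1 (hC.isFGIndecomposable hX)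
  obtain ⟨E, σ, hE, hσ, hmin⟩ := exists_leftAlmostSplit_minimal K X hX1 hX2
  obtain ⟨ι, _, Y, i, p, hY, h1, h0, hs⟩ := (isLengthClass_finite K R).isFiniteSum E hE
  refine ⟨E, σ, ⟨ι, inferInstance, Y, i, p, fun j => ?_, h1, h0, hs⟩, hσ⟩
  exact (hC.mem_of_step ⟨hC.isFGIndecomposable hX, isFGIndecomposable_iff.2 (hY j), Or.inr
    ⟨_, isIrreducibleHom_of_leftAlmostSplit hσ hmin hX2 (hY j).2.1 ⟨i j, p j, h1 j⟩⟩⟩).1 hX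

end IsARComponent

end Component

/-! ### Restriction along a surjective ring homomorphism -/

section FullyFaithful

open Limits

variable {𝒜 ℬ : Type*} [Category 𝒜] [Category ℬ] [Preadditive 𝒜] [Preadditive ℬ] (F : 𝒜 ⥤ ℬ)
  [F.Full] [F.Faithful] [F.Additive]

lemma isIdempotentFree_obj_iff {X : 𝒜} : IsIdempotentFree (F.obj X) ↔ IsIdempotentFree X := by
  refine and_congr (not_congr ?_) ⟨fun h e he => ?_, fun h e he => ?_⟩
  · rw [IsZero.iff_id_eq_zero, IsZero.iff_id_eq_zero, ← F.map_id, F.map_eq_zero_iff]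
  · refine (h (F.map e) (by rw [← F.map_comp, he])).imp (fun h => F.map_eq_zero_iff.1 h)
      fun h => ?_
    exact F.map_injective (by rw [h, F.map_id])
  · obtain ⟨e, rfl⟩ := F.map_surjective e
    refine (h e (F.map_injective (by rw [F.map_comp, he]))).imp (fun h => ?_) fun h => ?_
    · rw [h, F.map_zero]
    · rw [h, F.map_id]

lemma IsFiniteSum.of_obj {C : ℬ → Prop} {E : 𝒜} (h : IsFiniteSum C (F.obj E))
    (hC : ∀ Y, C Y → ∃ X, Nonempty (F.obj X ≅ Y)) (hiso : ∀ Y Z, C Y → (Y ≅ Z) → C Z) :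
    IsFiniteSum (fun X => C (F.obj X)) E := by
  obtain ⟨ι, _, Y, i, p, hY, h1, h0, hs⟩ := h
  choose X e using fun j => hC (Y j) (hY j)
  let e j := (e j).some
  refine ⟨ι, inferInstance, X, fun j => F.preimage ((e j).hom ≫ i j),
    fun j => F.preimage (p j ≫ (e j).inv), fun j => hiso _ _ (hY j) (e j).symm, fun j => ?_,
    fun j k hjk => ?_, ?_⟩
  · exact F.map_injective (by simp [reassoc_of% h1])
  · exact F.map_injective (by simp [reassoc_of% h0 j k hjk])
  · exact F.map_injective (by simp [F.map_sum, hs])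

end FullyFaithful

section Restriction

open Limits

variable {R S : Type u} [Ring R] [Ring S] {q : R →+* S}

lemma full_restrictScalars (hq : Function.Surjective q) :
    (ModuleCat.restrictScalars.{u} q).Full where
  map_surjective {X Y} f := ⟨ModuleCat.ofHom (X := X) (Y := Y)
    { toFun := f.hom
      map_add' := f.hom.map_add
      map_smul' := fun s x => by
        obtain ⟨r, rfl⟩ := hq s
        exact f.hom.map_smul r x }, rfl⟩

/-- A module annihilated by the kernel of a surjective ring homomorphism is a module over its
target. -/
lemma exists_restrictScalars_iso (hq : Function.Surjective q) (N : ModuleCat.{u} R)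
    (hN : ∀ r, q r = 0 → ∀ x : N, r • x = 0) :
    ∃ X : ModuleCat.{u} S, Nonempty ((ModuleCat.restrictScalars q).obj X ≅ N) := by
  let t := Function.surjInv hq
  have ht : ∀ s r (x : N), q r = s → t s • x = r • x := fun s r x h => by
    rw [← sub_eq_zero, ← sub_smul]
    exact hN _ (by rw [map_sub, Function.surjInv_eq hq, h, sub_self]) x
  have hqt : ∀ s, q (t s) = s := Function.surjInv_eq hq
  let _ : Module S N :=
    { smul := fun s x => t s • x
      one_smul := fun x => (ht 1 1 x q.map_one).trans (one_smul R x)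
      mul_smul := fun a b x => (ht (a * b) (t a * t b) x (by rw [map_mul, hqt, hqt])).trans
        (mul_smul _ _ x)
      smul_zero := fun a => smul_zero (t a)
      smul_add := fun a => smul_add (t a)
      add_smul := fun a b x => (ht (a + b) (t a + t b) x (by rw [map_add, hqt, hqt])).trans
        (add_smul _ _ x)
      zero_smul := fun x => (ht 0 0 x q.map_zero).trans (zero_smul R x) }
  let e : (ModuleCat.restrictScalars q).obj (ModuleCat.of S N) ≃ₗ[R] N :=
    { toFun := fun x => x
      invFun := fun x => x
      map_add' := fun _ _ => rfl
      map_smul' := fun r x => ht (q r) r x rfl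
      left_inv := fun _ => rfl
      right_inv := fun _ => rfl }
  exact ⟨ModuleCat.of S N, ⟨e.toModuleIso⟩⟩

lemma finite_restrictScalars_iff (hq : Function.Surjective q) (X : ModuleCat.{u} S) :
    Module.Finite R ((ModuleCat.restrictScalars q).obj X) ↔ Module.Finite S X := by
  constructor
  · intro _
    have : RingHomSurjective q := ⟨hq⟩
    exact Module.Finite.of_surjective (R := R) (M := (ModuleCat.restrictScalars q).obj X) (σ := q)
      { toFun := id, map_add' := fun _ _ => rfl, map_smul' := fun _ _ => rfl }
      Function.surjective_id
  · intro _
    obtain ⟨n, f, hf⟩ := Module.Finite.exists_fin' S X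
    refine Module.Finite.of_surjective (R := R) (M := Fin n → R)
      (P := (ModuleCat.restrictScalars q).obj X) (σ := RingHom.id R)
      { toFun := fun v => f fun i => q (v i)
        map_add' := fun v w => (congrArg f (funext fun i => map_add q (v i) (w i))).trans
          (f.map_add (fun i => q (v i)) fun i => q (w i))
        map_smul' := fun r v => (congrArg f (funext fun i => map_mul q r (v i))).trans
          (f.map_smul (q r) fun i => q (v i)) } fun x => ?_
    obtain ⟨v, rfl⟩ := hf x
    choose w hw using fun i => hq (v i)
    exact ⟨w, congrArg f (funext hw)⟩

lemma IsFiniteSum.smul_eq_zero {C : ModuleCat.{u} R → Prop} {E : ModuleCat.{u} R}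
    (h : IsFiniteSum C E) {r : R} (hr : ∀ X, C X → ∀ x : X, r • x = 0) (x : E) : r • x = 0 := by
  obtain ⟨ι, _, Y, i, p, hY, -, -, hs⟩ := h
  have hx : ∑ j, (i j).hom ((p j).hom x) = x := by
    have := congrArg (fun f : E ⟶ E => f.hom x) hs
    simpa [ModuleCat.hom_sum] using this
  rw [← hx, Finset.smul_sum]
  refine Finset.sum_eq_zero fun j _ => ?_
  rw [← map_smul, hr _ (hY j), map_zero]

end Restriction

/-! ### Components over a faithful quotient -/

section FaithfulQuotient

open Limits

variable {R S : Type u} [Ring R] [Ring S] {q : R →+* S} {C : Set (ModuleCat.{u} R)}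

/-- The class of modules over the target of a ring homomorphism `q` which belong to `C` as modules
over the source of `q`. -/
def restrictedClass (q : R →+* S) (C : Set (ModuleCat.{u} R)) (X : ModuleCat.{u} S) : Prop :=
  (ModuleCat.restrictScalars q).obj X ∈ C

lemma IsIdempotentFree.of_op {𝒜 : Type*} [Category 𝒜] [Preadditive 𝒜] {X : 𝒜ᵒᵖ}
    (h : IsIdempotentFree X) : IsIdempotentFree X.unop :=
  ⟨fun hz => h.1 hz.op, fun e he => (h.2 e.op (by rw [← op_comp, he])).imp
    (fun h => Quiver.Hom.op_inj h) fun h => Quiver.Hom.op_inj h⟩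

lemma restrictedClass_no_short_path (hq : Function.Surjective q) (hC : IsARComponent C)
    (hext : ¬ HasExternalShortPath C) {X Y Z : ModuleCat.{u} S} (f : X ⟶ Y) (g : Y ⟶ Z)
    (hX : restrictedClass q C X) (hY : Module.Finite S Y) (hYi : IsIdempotentFree Y)
    (hYC : ¬ restrictedClass q C Y) (hZ : restrictedClass q C Z) (hf : f ≠ 0) : g = 0 := by
  have := full_restrictScalars hq
  by_contra hg
  let F := ModuleCat.restrictScalars.{u} q
  refine hext ⟨F.obj X, F.obj Y, F.obj Z, F.map f, F.map g, hC.isFGIndecomposable hX,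
    isFGIndecomposable_iff.2 ⟨(finite_restrictScalars_iff hq Y).2 hY,
      (isIdempotentFree_obj_iff F).2 hYi⟩, hC.isFGIndecomposable hZ, hX, hYC, hZ,
    mt F.map_eq_zero_iff.1 hf, fun _ => hYC (hC.mem_of_iso hX (asIso (F.map f))),
    mt F.map_eq_zero_iff.1 hg, fun _ => hYC (hC.mem_of_iso hZ (asIso (F.map g)).symm)⟩

/-- If `C` is annihilated by the kernel of `q`, then direct sums of modules in `C` are modules over
the target of `q`. -/
lemma exists_isFiniteSum_restrictedClass (hq : Function.Surjective q) (hC : IsARComponent C)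
    (hker : ∀ r, q r = 0 ↔ ∀ X ∈ C, ∀ x : X, r • x = 0) {E : ModuleCat.{u} R}
    (hE : IsFiniteSum (· ∈ C) E) : ∃ X : ModuleCat.{u} S, IsFiniteSum (restrictedClass q C) X ∧
      Nonempty ((ModuleCat.restrictScalars q).obj X ≅ E) := by
  have := full_restrictScalars hq
  obtain ⟨X, ⟨e⟩⟩ := exists_restrictScalars_iso hq E fun r hr =>
    hE.smul_eq_zero ((hker r).1 hr)
  refine ⟨X, IsFiniteSum.of_obj (ModuleCat.restrictScalars q) (C := (· ∈ C)) ?_ (fun Y hY =>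
    exists_restrictScalars_iso hq Y fun r hr => (hker r).1 hr Y hY)
    (fun Y Z hY e => hC.mem_of_iso hY e), ⟨e⟩⟩
  obtain ⟨ι, _, Y, i, p, hY, h1, h0, hs⟩ := hE
  exact ⟨ι, inferInstance, Y, fun j => i j ≫ e.inv, fun j => e.hom ≫ p j, hY, by simp [h1],
    fun j k hjk => by simp [h0 j k hjk], by
      have := congrArg (fun f => e.hom ≫ f ≫ e.inv) hs
      simpa [Preadditive.sum_comp, Preadditive.comp_sum] using this⟩

/-- Over an artin algebra a projective module is cogenerated by a class of modules on which the
algebra acts faithfully. -/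
lemma exists_mono_isFiniteSum_of_projective (hq : Function.Surjective q)
    [IsArtinianRing S] (hker : ∀ r, q r = 0 ↔ ∀ X ∈ C, ∀ x : X, r • x = 0)
    (hC : IsARComponent C) (Q : ModuleCat.{u} S) (hQ : Module.Finite S Q) (hQp : Projective Q) :
    ∃ (M : ModuleCat.{u} S) (i : Q ⟶ M), Mono i ∧ IsFiniteSum (restrictedClass q C) M := by
  have hsep : ∀ x : Q, x ≠ 0 →
      ∃ (X : ModuleCat.{u} S) (f : Q →ₗ[S] X), restrictedClass q C X ∧ f x ≠ 0 := by
    intro x hx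
    obtain ⟨s, hs⟩ := Module.projective_def.1 ((IsProjective.iff_projective (R := S) Q).2 hQp)
    have hsx : s x ≠ 0 := fun h => hx (by rw [← hs x, h, map_zero])
    obtain ⟨y, hy⟩ := Finsupp.ne_iff.1 hsx
    obtain ⟨r, hr⟩ := hq (s x y)
    have hr0 : q r ≠ 0 := hr ▸ hy
    rw [Ne, hker] at hr0
    push Not at hr0
    obtain ⟨Y, hY, z, hz⟩ := hr0
    obtain ⟨X, ⟨e⟩⟩ := exists_restrictScalars_iso hq Y fun r hr => (hker r).1 hr Y hY
    refine ⟨X, (LinearMap.toSpanSingleton S X (e.inv.hom z)) ∘ₗ Finsupp.lapply y ∘ₗ s,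
      hC.mem_of_iso hY e.symm, fun h0 => hz ?_⟩
    have h1 : e.inv.hom (r • z) = 0 := by
      rw [map_smul]
      change q r • e.inv.hom z = (0 : X)
      rw [hr]
      exact h0
    calc r • z = e.hom.hom (e.inv.hom (r • z)) :=
          (congrArg (fun f : Y ⟶ Y => f.hom (r • z)) e.inv_hom_id).symm
      _ = 0 := by rw [h1, map_zero]
  -- a morphism to a direct sum of modules in the class with minimal kernel is injective
  let s : Set (Submodule S Q) :=
    {U | ∃ (M : ModuleCat.{u} S) (i : Q ⟶ M), IsFiniteSum (restrictedClass q C) M ∧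
      LinearMap.ker i.hom = U}
  have hs : s.Nonempty := ⟨_, ModuleCat.of S PUnit, 0,
    .of_isZero (ModuleCat.isZero_of_subsingleton _), rfl⟩
  obtain ⟨M, i, hM, hi⟩ := WellFounded.min_mem wellFounded_lt s hs
  refine ⟨M, i, (ModuleCat.mono_iff_ker_eq_bot i).2 ?_, hM⟩
  by_contra hne
  obtain ⟨x, hx, hx0⟩ := Submodule.exists_mem_ne_zero_of_ne_bot hne
  obtain ⟨X, f, hX, hf⟩ := hsep x hx0
  refine WellFounded.not_lt_min wellFounded_lt s (x := LinearMap.ker i.hom ⊓ LinearMap.ker f)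
    ⟨ModuleCat.of S (M × X), ModuleCat.ofHom (i.hom.prod f), ?_, LinearMap.ker_prod _ _⟩ ?_
  · refine IsFiniteSum.of_retracts (X := M) (Y := X)
      ⟨ModuleCat.ofHom (LinearMap.inl S M X), ModuleCat.ofHom (LinearMap.fst S M X), rfl⟩
      ⟨ModuleCat.ofHom (LinearMap.inr S M X), ModuleCat.ofHom (LinearMap.snd S M X), rfl⟩
      rfl rfl ?_ hM (.single hX)
    exact ModuleCat.hom_ext (LinearMap.ext fun x : M × X =>
      Prod.ext (add_zero x.1) (zero_add x.2))
  · rw [← hi]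
    exact lt_of_le_of_ne inf_le_left fun h => hf ((inf_eq_left.1 h) hx)

lemma exists_epi_isFiniteSum_of_injective (K : Type u) [CommRing K] [IsArtinianRing K] [Algebra K S]
    [Module.Finite K S] (hq : Function.Surjective q)
    (hker : ∀ r, q r = 0 ↔ ∀ X ∈ C, ∀ x : X, r • x = 0)
    (hC : IsARComponent C) (J : ModuleCat.{u} S) (hJ : Module.Finite S J) (hJi : Injective J) :
    ∃ (M : ModuleCat.{u} S) (e : M ⟶ J), Epi e ∧ IsFiniteSum (restrictedClass q C) M := by
  have : IsArtinianRing S := isArtinian_of_tower K inferInstance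
  obtain ⟨Q, p, hQ, hQp, _⟩ := (isLengthClass_finite K S).enoughProjectives J hJ
  obtain ⟨M, i, _, hM⟩ := exists_mono_isFiniteSum_of_projective hq hker hC Q hQ hQp
  refine ⟨M, Injective.factorThru p i, ?_, hM⟩
  have : Epi (i ≫ Injective.factorThru p i) := by
    rw [Injective.comp_factorThru]
    infer_instance
  exact epi_of_epi i _

lemma exists_rightAlmostSplit_restrictedClass (K : Type u) [CommRing K] [IsArtinianRing K]
    [Algebra K R] [Module.Finite K R]
    (hq : Function.Surjective q)
    (hker : ∀ r, q r = 0 ↔ ∀ X ∈ C, ∀ x : X, r • x = 0)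
    (hC : IsARComponent C) {X : ModuleCat.{u} S} (hX : restrictedClass q C X) :
    ∃ (E : ModuleCat.{u} S) (π : E ⟶ X), IsFiniteSum (restrictedClass q C) E ∧
      IsRightAlmostSplit (fun Y : ModuleCat.{u} S => Module.Finite S Y) π := by
  have := full_restrictScalars hq
  let F := ModuleCat.restrictScalars.{u} q
  obtain ⟨E', π, hE', hπ⟩ := hC.exists_rightAlmostSplit K hX
  obtain ⟨E, hE, ⟨e⟩⟩ := exists_isFiniteSum_restrictedClass hq hC hker hE'
  refine ⟨E, F.preimage (e.hom ≫ π), hE, ?_, fun Y f hY hf => ?_⟩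
  · rintro ⟨⟨s⟩⟩
    refine hπ.1 ⟨⟨⟨F.map s.section_ ≫ e.hom, ?_⟩⟩⟩
    have := congrArg F.map s.id
    rwa [F.map_comp, F.map_preimage, F.map_id, ← Category.assoc] at this
  · obtain ⟨g, hg⟩ := hπ.2 (F.obj Y) (F.map f) ((finite_restrictScalars_iff hq Y).2 hY)
      fun ⟨⟨s⟩⟩ => hf ⟨⟨⟨F.preimage s.section_, F.map_injective (by
        rw [F.map_comp, F.map_preimage, s.id, F.map_id])⟩⟩⟩
    exact ⟨F.preimage (g ≫ e.inv), F.map_injective (by simp [hg])⟩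

lemma exists_leftAlmostSplit_restrictedClass (K : Type u) [CommRing K] [IsArtinianRing K]
    [Algebra K R] [Module.Finite K R]
    (hq : Function.Surjective q)
    (hker : ∀ r, q r = 0 ↔ ∀ X ∈ C, ∀ x : X, r • x = 0)
    (hC : IsARComponent C) {X : ModuleCat.{u} S} (hX : restrictedClass q C X) :
    ∃ (E : ModuleCat.{u} S) (σ : X ⟶ E), IsFiniteSum (restrictedClass q C) E ∧
      IsLeftAlmostSplit (fun Y : ModuleCat.{u} S => Module.Finite S Y) σ := by
  have := full_restrictScalars hq
  let F := ModuleCat.restrictScalars.{u} q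
  obtain ⟨E', σ, hE', hσ⟩ := hC.exists_leftAlmostSplit K hX
  obtain ⟨E, hE, ⟨e⟩⟩ := exists_isFiniteSum_restrictedClass hq hC hker hE'
  refine ⟨E, F.preimage (σ ≫ e.inv), hE, ?_, fun Y f hY hf => ?_⟩
  · rintro ⟨⟨s⟩⟩
    refine hσ.1 ⟨⟨⟨e.inv ≫ F.map s.retraction, ?_⟩⟩⟩
    have := congrArg F.map s.id
    rwa [F.map_comp, F.map_preimage, F.map_id, Category.assoc] at this
  · obtain ⟨g, hg⟩ := hσ.2 (F.obj Y) (F.map f) ((finite_restrictScalars_iff hq Y).2 hY)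
      fun ⟨⟨s⟩⟩ => hf ⟨⟨⟨F.preimage s.retraction, F.map_injective (by
        rw [F.map_comp, F.map_preimage, s.id, F.map_id])⟩⟩⟩
    exact ⟨F.preimage (e.hom ≫ g), F.map_injective (by simp [hg])⟩

/-- A module in `C` which is not injective is a proper submodule of some module, so that its left
almost split map is injective. The target of this map is a module over the target of `q`. -/
lemma not_injective_of_restrictedClass (K : Type u) [CommRing K] [IsArtinianRing K]
    [Algebra K R] [Module.Finite K R]
    (hq : Function.Surjective q)
    (hker : ∀ r, q r = 0 ↔ ∀ X ∈ C, ∀ x : X, r • x = 0) (hC : IsARComponent C)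
    (hinj : ∀ X ∈ C, ¬ Injective X) {X : ModuleCat.{u} S} (hX : restrictedClass q C X) :
    ¬ Injective X := by
  intro _
  have := full_restrictScalars hq
  let F := ModuleCat.restrictScalars.{u} q
  obtain ⟨E', σ, hE', hσ⟩ := hC.exists_leftAlmostSplit K hX
  obtain ⟨E, hE, ⟨e⟩⟩ := exists_isFiniteSum_restrictedClass hq hC hker hE'
  obtain ⟨J, i, hJ, hJi, _⟩ := (isLengthClass_finite K R).enoughInjectives (F.obj X)
    (hC.isFGIndecomposable hX).1
  obtain ⟨g, hg⟩ := hσ.2 J i hJ fun ⟨⟨s⟩⟩ => hinj _ hX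
    (Retract.injective ⟨i, s.retraction, s.id⟩)
  have : Mono (σ ≫ g) := by rw [hg]; infer_instance
  have : Mono σ := mono_of_mono σ g
  obtain ⟨m, hm⟩ := F.map_surjective (σ ≫ e.inv)
  have : Mono m := F.mono_of_mono_map (by rw [hm]; infer_instance)
  refine hσ.1 ⟨⟨⟨e.inv ≫ F.map (Injective.factorThru (𝟙 X) m), ?_⟩⟩⟩
  rw [← Category.assoc, ← hm, ← F.map_comp, Injective.comp_factorThru, F.map_id]

lemma not_projective_of_restrictedClass (K : Type u) [CommRing K] [IsArtinianRing K]
    [Algebra K R] [Module.Finite K R]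
    (hq : Function.Surjective q)
    (hker : ∀ r, q r = 0 ↔ ∀ X ∈ C, ∀ x : X, r • x = 0) (hC : IsARComponent C)
    (hproj : ∀ X ∈ C, ¬ Projective X) {X : ModuleCat.{u} S} (hX : restrictedClass q C X) :
    ¬ Projective X := by
  intro _
  have := full_restrictScalars hq
  let F := ModuleCat.restrictScalars.{u} q
  obtain ⟨E', π, hE', hπ⟩ := hC.exists_rightAlmostSplit K hX
  obtain ⟨E, hE, ⟨e⟩⟩ := exists_isFiniteSum_restrictedClass hq hC hker hE'
  obtain ⟨Q, p, hQ, hQp, _⟩ := (isLengthClass_finite K R).enoughProjectives (F.obj X)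
    (hC.isFGIndecomposable hX).1
  obtain ⟨g, hg⟩ := hπ.2 Q p hQ fun ⟨⟨s⟩⟩ => hproj _ hX
    (Retract.projective ⟨s.section_, p, s.id⟩)
  have : Epi (g ≫ π) := by rw [hg]; infer_instance
  have : Epi π := epi_of_epi g π
  obtain ⟨m, hm⟩ := F.map_surjective (e.hom ≫ π)
  have : Epi m := F.epi_of_epi_map (by rw [hm]; infer_instance)
  refine hπ.1 ⟨⟨⟨F.map (Projective.factorThru (𝟙 X) m) ≫ e.hom, ?_⟩⟩⟩
  rw [Category.assoc, ← hm, ← F.map_comp, Projective.factorThru_comp, F.map_id]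

lemma isPathClosedFaithfulClass_of_not_injective (K : Type u) [CommRing K] [IsArtinianRing K]
    [Algebra K R] [Module.Finite K R] [Algebra K S] [Module.Finite K S]
    (hq : Function.Surjective q)
    (hker : ∀ r, q r = 0 ↔ ∀ X ∈ C, ∀ x : X, r • x = 0) (hC : IsARComponent C)
    (hext : ¬ HasExternalShortPath C) (hinj : ∀ X ∈ C, ¬ Injective X) :
    IsPathClosedFaithfulClass (fun X : ModuleCat.{u} S => Module.Finite S X)
      (restrictedClass q C) where
  no_short_path _ _ _ f g := restrictedClass_no_short_path hq hC hext f g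
  cogenerates Q hQ hQp :=
    have : IsArtinianRing S := isArtinian_of_tower K inferInstance
    exists_mono_isFiniteSum_of_projective hq hker hC Q hQ hQp
  generates J hJ hJi := exists_epi_isFiniteSum_of_injective K hq hker hC J hJ hJi
  not_injective _ hX := not_injective_of_restrictedClass K hq hker hC hinj hX
  almostSplit X hX hXi _ := exists_rightAlmostSplit_minimal K X hX hXi
  almostSplit_mem _ hX _ := exists_rightAlmostSplit_restrictedClass K hq hker hC hX

lemma isPathClosedFaithfulClass_of_not_projective (K : Type u) [CommRing K] [IsArtinianRing K]
    [Algebra K R] [Module.Finite K R] [Algebra K S] [Module.Finite K S]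
    (hq : Function.Surjective q)
    (hker : ∀ r, q r = 0 ↔ ∀ X ∈ C, ∀ x : X, r • x = 0) (hC : IsARComponent C)
    (hext : ¬ HasExternalShortPath C) (hproj : ∀ X ∈ C, ¬ Projective X) :
    IsPathClosedFaithfulClass (fun X : (ModuleCat.{u} S)ᵒᵖ => Module.Finite S X.unop)
      (fun X => restrictedClass q C X.unop) where
  no_short_path _ _ _ f g hX hY hYi hYC hZ hf := by
    by_contra hg
    exact hf (Quiver.Hom.unop_inj (restrictedClass_no_short_path hq hC hext g.unop f.unop hZ hY
      hYi.of_op hYC hX fun h => hg (Quiver.Hom.unop_inj h)))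
  cogenerates Q hQ hQp := by
    obtain ⟨M, e, _, hM⟩ := exists_epi_isFiniteSum_of_injective K hq hker hC Q.unop hQ inferInstance
    exact ⟨.op M, e.op, inferInstanceAs (Mono e.op), hM.op⟩
  generates J hJ hJi := by
    have : IsArtinianRing S := isArtinian_of_tower K inferInstance
    obtain ⟨M, i, _, hM⟩ :=
      exists_mono_isFiniteSum_of_projective hq hker hC J.unop hJ inferInstance
    exact ⟨.op M, i.op, inferInstanceAs (Epi i.op), hM.op⟩
  not_injective _ hX h := not_projective_of_restrictedClass K hq hker hC hproj hX inferInstance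
  almostSplit X hX hXi _ := by
    obtain ⟨E, σ, hE, hσ, hmin⟩ := exists_leftAlmostSplit_minimal K X.unop hX hXi.of_op
    exact ⟨.op E, σ.op, hE, hσ.op, hmin.op⟩
  almostSplit_mem _ hX _ := by
    obtain ⟨E, σ, hE, hσ⟩ := exists_leftAlmostSplit_restrictedClass K hq hker hC hX
    exact ⟨.op E, σ.op, hE.op, hσ.op⟩

end FaithfulQuotient

/-! ### Global dimension -/

section GlobalDimension

open Limits Abelian

variable {𝒜 : Type*} [Category 𝒜] [Abelian 𝒜]

lemma ext_eq_zero_of_projective_X₂ [HasExt 𝒜] {T : ShortComplex 𝒜} (hT : T.ShortExact)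
    [Projective T.X₂] {L : 𝒜} {n : ℕ} (h : ∀ e : Ext T.X₃ L (n + 2), e = 0)
    (e : Ext T.X₁ L (n + 1)) : e = 0 := by
  obtain ⟨x, rfl⟩ := Ext.contravariant_sequence_exact₁ hT L e (n₁ := n + 2) (by omega) (h _)
  rw [Ext.eq_zero_of_projective x, Ext.comp_zero]

lemma ext_eq_zero_of_injective_X₂ [HasExt 𝒜] {T : ShortComplex 𝒜} (hT : T.ShortExact)
    [Injective T.X₂] {L : 𝒜} {n : ℕ} (h : ∀ e : Ext L T.X₁ (n + 2), e = 0)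
    (e : Ext L T.X₃ (n + 1)) : e = 0 := by
  obtain ⟨x, rfl⟩ := Ext.covariant_sequence_exact₃ L hT e (n₁ := n + 2) (by omega) (h _)
  rw [Ext.eq_zero_of_injective x, Ext.zero_comp]

lemma projective_X₃_of_ext_eq_zero [HasExt 𝒜] {T : ShortComplex 𝒜} (hT : T.ShortExact)
    [Projective T.X₂] (h : ∀ e : Ext T.X₃ T.X₁ 1, e = 0) : Projective T.X₃ := by
  obtain ⟨x, hx⟩ := Ext.covariant_sequence_exact₃ T.X₃ hT (Ext.mk₀ (𝟙 _)) (n₁ := 1) (by omega) (h _)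
  obtain ⟨s, rfl⟩ := (Ext.mk₀_bijective _ _).2 x
  rw [Ext.mk₀_comp_mk₀] at hx
  exact Retract.projective (Y := T.X₂) ⟨s, T.g, (Ext.mk₀_bijective _ _).1 hx⟩

/-- If all objects of a length class have injective dimension at most two, then they have
projective dimension at most two: a second syzygy `U` is projective, since its extensions by a
third syzygy `L` are classified by `Ext³(N, L)`. -/
lemma IsLengthClass.hasProjectiveDimensionLT_three {P : 𝒜 → Prop} (hP : IsLengthClass P)
    (h : ∀ X, P X → HasInjectiveDimensionLT X 3) {N : 𝒜} (hN : P N) :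
    HasProjectiveDimensionLT N 3 := by
  let := HasExt.standard 𝒜
  obtain ⟨Q, f, hQ, _, _⟩ := hP.enoughProjectives N hN
  have hU := hP.of_mono (kernel.ι f) inferInstance hQ
  obtain ⟨Q', f', hQ', _, _⟩ := hP.enoughProjectives _ hU
  have hU' := hP.of_mono (kernel.ι f') inferInstance hQ'
  obtain ⟨Q'', f'', hQ'', _, _⟩ := hP.enoughProjectives _ hU'
  have hL := hP.of_mono (kernel.ι f'') inferInstance hQ''
  have := h _ hL
  have h3 : ∀ e : Ext N (kernel f'') 3, e = 0 := fun e =>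
    Ext.eq_zero_of_hasInjectiveDimensionLT e 3 le_rfl
  have h2 := fun e => ext_eq_zero_of_projective_X₂ (shortExact_kernel f) (n := 1) h3 e
  have h1 := fun e => ext_eq_zero_of_projective_X₂ (shortExact_kernel f') (n := 0) h2 e
  have : Projective (kernel f') := projective_X₃_of_ext_eq_zero (shortExact_kernel f'') h1
  refine ((shortExact_kernel f).hasProjectiveDimensionLT_X₃_iff 1 inferInstance).2
    (((shortExact_kernel f').hasProjectiveDimensionLT_X₃_iff 0 inferInstance).2 ?_)
  dsimp
  infer_instance

variable {S : Type u} [Ring S]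

/-- Baer's criterion in terms of `Ext`. -/
lemma injective_of_ext_eq_zero (M : ModuleCat.{u} S)
    (h : ∀ (I : Ideal S) (e : Ext (ModuleCat.of S (S ⧸ I)) M 1), e = 0) : Injective M := by
  have hB : Module.Baer S M := by
    intro I g
    let T : ShortComplex (ModuleCat.{u} S) := ShortComplex.mk (ModuleCat.ofHom I.subtype)
      (ModuleCat.ofHom I.mkQ) (by ext x; simp)
    have hT : T.ShortExact :=
      { exact := by
          rw [ShortComplex.moduleCat_exact_iff_range_eq_ker]
          simp [T]
        mono_f := (ModuleCat.mono_iff_injective _).2 I.injective_subtype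
        epi_g := (ModuleCat.epi_iff_surjective _).2 I.mkQ_surjective }
    obtain ⟨x, hx⟩ := Ext.contravariant_sequence_exact₁ hT M
      (Ext.mk₀ (ModuleCat.ofHom g : T.X₁ ⟶ M)) (n₁ := 1) (by omega) (h I _)
    obtain ⟨s, rfl⟩ := (Ext.mk₀_bijective _ _).2 x
    rw [Ext.mk₀_comp_mk₀] at hx
    have hs := (Ext.mk₀_bijective _ _).1 hx
    exact ⟨s.hom, fun y hy => congrArg (fun f : T.X₁ ⟶ M => f.hom ⟨y, hy⟩) hs⟩
  have := hB.injective
  exact Module.injective_object_of_injective_module S M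

/-- The global dimension of a ring is bounded by the projective dimensions of the cyclic modules. -/
lemma hasProjectiveDimensionLT_three_of_finite
    (h : ∀ X : ModuleCat.{u} S, Module.Finite S X → HasProjectiveDimensionLT X 3)
    (M : ModuleCat.{u} S) : HasProjectiveDimensionLT M 3 := by
  have hinj : ∀ M : ModuleCat.{u} S, HasInjectiveDimensionLT M 3 := by
    intro M
    let J := Injective.under M
    let f := Injective.ι M
    let f' := Injective.ι (cokernel f)
    have : Injective (cokernel f') := injective_of_ext_eq_zero _ fun I => by
      have := h (ModuleCat.of S (S ⧸ I)) (inferInstanceAs (Module.Finite S (S ⧸ I)))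
      have h3 : ∀ e : Ext (ModuleCat.of S (S ⧸ I)) M 3, e = 0 := fun e =>
        Ext.eq_zero_of_hasProjectiveDimensionLT e 3 le_rfl
      have h2 := fun e => ext_eq_zero_of_injective_X₂ (shortExact_cokernel f) (n := 1) h3 e
      exact fun e => ext_eq_zero_of_injective_X₂ (shortExact_cokernel f') (n := 0) h2 e
    refine ((shortExact_cokernel f).hasInjectiveDimensionLT_X₃_iff 1 inferInstance).1
      (((shortExact_cokernel f').hasInjectiveDimensionLT_X₃_iff 0 inferInstance).1 ?_)
    dsimp
    infer_instance
  rw [hasProjectiveDimensionLT_iff]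
  intro i hi Y e
  have := hinj Y
  exact Ext.eq_zero_of_hasInjectiveDimensionLT e 3 hi

end GlobalDimension

/-! ### Quotients of basic rings -/

section Basic

/-- A quotient of a finite product of division rings is the product of the factors in which it does
not vanish. -/
lemma exists_ringEquiv_pi_divisionRing {n : ℕ} {D : Fin n → Type u} [∀ i, DivisionRing (D i)]
    {Q : Type u} [Ring Q] (g : ((i : Fin n) → D i) →+* Q) (hg : Function.Surjective g) :
    ∃ (m : ℕ) (s : Fin m → Fin n), Nonempty (Q ≃+* ((j : Fin m) → D (s j))) := by
  classical
  let T := {i : Fin n // g (Pi.single i 1) ≠ 0}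
  let e : T ≃ Fin (Fintype.card T) := Fintype.equivFin T
  let s : Fin (Fintype.card T) → Fin n := fun j => (e.symm j).1
  have hs : Function.Injective s := Subtype.val_injective.comp e.symm.injective
  let ρ : ((i : Fin n) → D i) →+* ((j : Fin (Fintype.card T)) → D (s j)) :=
    RingHom.pi fun j => Pi.evalRingHom D (s j)
  have hρ : Function.Surjective ρ := fun y => by
    refine ⟨∑ k, Pi.single (s k) (y k), funext fun j => ?_⟩
    change (∑ k, Pi.single (s k) (y k) : (i : Fin n) → D i) (s j) = y j
    rw [Finset.sum_apply, Fintype.sum_eq_single j fun k hk =>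
      Pi.single_eq_of_ne (fun h => hk (hs h).symm) _, Pi.single_eq_same]
  have hker : RingHom.ker g = RingHom.ker ρ := by
    ext x
    rw [RingHom.mem_ker, RingHom.mem_ker]
    constructor
    · intro hx
      funext j
      by_contra hne
      refine (e.symm j).2 ?_
      have : Pi.single (s j) (x (s j))⁻¹ * x = Pi.single (s j) 1 := by
        rw [← Pi.single_mul_left]
        exact congrArg _ (inv_mul_cancel₀ hne)
      change g (Pi.single (s j) 1) = 0
      rw [← this, map_mul, hx, mul_zero]
    · intro hx
      rw [← Finset.univ_sum_single x, map_sum]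
      refine Finset.sum_eq_zero fun i _ => ?_
      by_cases hi : g (Pi.single i 1) = 0
      · rw [← mul_one (x i), Pi.single_mul, map_mul, hi, mul_zero]
      · obtain ⟨j, hj⟩ := e.symm.surjective ⟨i, hi⟩
        obtain rfl : s j = i := congrArg Subtype.val hj
        have h0 : x (s j) = 0 := congrFun hx j
        rw [h0, Pi.single_zero, map_zero]
  exact ⟨_, _, ⟨(RingHom.quotientKerEquivOfSurjective hg).symm.trans
    ((Ideal.quotEquivOfEq hker).trans (RingHom.quotientKerEquivOfSurjective hρ))⟩⟩

lemma IsBasicRing.of_surjective {A B : Type u} [Ring A] [Ring B] (hA : IsBasicRing A) (f : A →+* B)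
    (hf : Function.Surjective f) : IsBasicRing B := by
  obtain ⟨n, D, _, ⟨e⟩⟩ := hA
  have : RingHomSurjective f := ⟨hf⟩
  let h : A ⧸ Ring.jacobson A →+* B ⧸ Ring.jacobson B :=
    Ideal.quotientMap _ f (Ring.le_comap_jacobson f)
  have hh : Function.Surjective h := Ideal.quotientMap_surjective hf
  obtain ⟨m, s, e'⟩ := exists_ringEquiv_pi_divisionRing (h.comp e.symm.toRingHom)
    (hh.comp e.symm.surjective)
  exact ⟨m, fun j => D (s j), inferInstance, e'⟩

end Basic

/-! ### Connectedness -/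

section Connected

open Limits

variable {R S : Type u} [Ring R] [Ring S] {q : R →+* S} {C : Set (ModuleCat.{u} R)}

/-- A ring acting faithfully on a component is connected: a central idempotent acts on every
module in the component as zero or as the identity, and modules with a non-zero homomorphism between
them belong to the same case. -/
lemma isConnectedRing_of_isARComponent (hq : Function.Surjective q)
    (hker : ∀ r, q r = 0 ↔ ∀ X ∈ C, ∀ x : X, r • x = 0) (hC : IsARComponent C) :
    IsConnectedRing S := by
  obtain ⟨W, hW⟩ : ∃ W, W ∈ C := by
    obtain ⟨W, _, rfl⟩ := id hC
    exact ⟨W, .refl W⟩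
  constructor
  · refine ⟨1, 0, fun h => ?_⟩
    have := (hC.isIdempotentFree hW).nontrivial
    obtain ⟨x, hx⟩ := exists_ne (0 : W)
    rw [← map_one q, hker] at h
    exact hx (by rw [← one_smul R x, h W hW x])
  intro e he hcomm
  obtain ⟨r, rfl⟩ := hq e
  have hr : ∀ X ∈ C, ∀ x : X, r • r • x = r • x := fun X hX x => by
    rw [← sub_eq_zero, ← mul_smul, ← sub_smul]
    exact (hker _).1 (by rw [map_sub, map_mul, he.eq, sub_self]) X hX x
  have hrc : ∀ X ∈ C, ∀ (a : R) (x : X), r • a • x = a • r • x := fun X hX a x => by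
    rw [← sub_eq_zero, ← mul_smul, ← mul_smul, ← sub_smul]
    exact (hker _).1 (by rw [map_sub, map_mul, map_mul, hcomm, sub_self]) X hX x
  have h01 : ∀ X ∈ C, (∀ x : X, r • x = 0) ∨ ∀ x : X, r • x = x := fun X hX => by
    let φ : Module.End R X :=
      { toFun := fun x => r • x
        map_add' := smul_add r
        map_smul' := fun a x => hrc X hX a x }
    exact ((hC.isIdempotentFree hX).end_eq φ (LinearMap.ext fun x => hr X hX x)).imp
      (fun h x => LinearMap.congr_fun h x) fun h x => LinearMap.congr_fun h x
  have hstep : ∀ Y Z, ARStep Y Z →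
      ((Y ∈ C ∧ ∀ x : Y, r • x = 0) ↔ (Z ∈ C ∧ ∀ x : Z, r • x = 0)) := by
    intro Y Z h
    rw [hC.mem_of_step h]
    refine and_congr_right fun hZ => ?_
    have hY := (hC.mem_of_step h).2 hZ
    obtain ⟨f, hf⟩ : ∃ f : Y ⟶ Z, f ≠ 0 := by
      obtain ⟨-, -, ⟨⟨e⟩⟩ | ⟨f, hf⟩⟩ := h
      · refine ⟨e.hom, fun h0 => (hC.isIdempotentFree hY).1 ?_⟩
        rw [IsZero.iff_id_eq_zero, ← e.hom_inv_id, h0, zero_comp]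
      · exact ⟨f, hf.ne_zero (hC.isIdempotentFree hY).1 (hC.isIdempotentFree hZ).1⟩
    obtain ⟨x, hx⟩ : ∃ x, f.hom x ≠ 0 := by
      by_contra! h0
      exact hf (ModuleCat.hom_ext (LinearMap.ext h0))
    constructor
    · intro h0
      refine (h01 Z hZ).resolve_right fun h1 => hx ?_
      rw [← h1 (f.hom x), ← map_smul, h0, map_zero]
    · intro h0
      refine (h01 Y hY).resolve_right fun h1 => hx ?_
      rw [← h1 x, map_smul, h0]
  by_cases h : ∃ X ∈ C, ∀ x : X, r • x = 0
  · obtain ⟨X, hX, hX0⟩ := h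
    exact Or.inl ((hker r).2 fun Y hY => (hC.induction hX ⟨hX, hX0⟩ hstep hY).2)
  · right
    rw [← map_one q, ← sub_eq_zero, ← map_sub, hker]
    intro Y hY y
    rw [sub_smul, one_smul, (h01 Y hY).resolve_left (fun h0 => h ⟨Y, hY, h0⟩) y, sub_self]

lemma IsConnectedRing.of_mulOpposite {B : Type u} [Ring B] (h : IsConnectedRing Bᵐᵒᵖ) :
    IsConnectedRing B := by
  have := h.1
  refine ⟨MulOpposite.unop_injective.nontrivial, fun e he hc => ?_⟩
  refine (h.2 (MulOpposite.op e) (congrArg MulOpposite.op he) fun a => ?_).imp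
    (fun h => MulOpposite.op_injective h) fun h => MulOpposite.op_injective h
  exact congrArg MulOpposite.op (hc a.unop).symm

end Connected

/-! ### The quotient by the annihilator of a component -/

section Quotient

/-- If `S` is the quotient of `R` by the annihilator of a component `C`, then `S` has the
homological properties of a quasi-tilted algebra. If `C` has no injectives,
`C` is a path closed faithful class of `S`-modules; otherwise it has no projectives, and it is
such a class in the opposite category. -/
lemma homologicalDimensions_of_isARComponent {R S : Type u} [Ring R] [Ring S] {q : R →+* S}
    {C : Set (ModuleCat.{u} R)} (K : Type u) [CommRing K] [IsArtinianRing K]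
    [Algebra K R] [Module.Finite K R] [Algebra K S] [Module.Finite K S]
    (hq : Function.Surjective q) (hker : ∀ r, q r = 0 ↔ ∀ X ∈ C, ∀ x : X, r • x = 0)
    (hC : IsARComponent C) (hsemi : IsSemiRegular C) (hext : ¬ HasExternalShortPath C) :
    (∀ M : ModuleCat.{u} S, HasProjectiveDimensionLT M 3) ∧
      ∀ M : ModuleCat.{u} S, Module.Finite S M → IsIdempotentFree M →
        HasProjectiveDimensionLT M 2 ∨ HasInjectiveDimensionLT M 2 := by
  have hP := isLengthClass_finite K S
  by_cases hp : ∃ P ∈ C, Module.Projective R P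
  · have h := isPathClosedFaithfulClass_of_not_injective K hq hker hC hext fun X hX hXi =>
      hsemi ⟨hp, X, hX, (Module.injective_iff_injective_object R X).2 hXi⟩
    exact ⟨hasProjectiveDimensionLT_three_of_finite fun X hX =>
      h.hasProjectiveDimensionLT_three hP hX,
      fun M hM hMi => h.hasProjectiveDimensionLT_two_or hP hM hMi⟩
  · have h := isPathClosedFaithfulClass_of_not_projective K hq hker hC hext fun X hX hXp =>
      hp ⟨X, hX, (IsProjective.iff_projective (R := R) X).2 hXp⟩
    refine ⟨hasProjectiveDimensionLT_three_of_finite fun X hX =>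
      hP.hasProjectiveDimensionLT_three (fun Y hY => hP.hasInjectiveDimensionLT_of_op 2 hY
        (h.hasProjectiveDimensionLT_three hP.op (N := .op Y) hY)) hX, fun M hM hMi => ?_⟩
    exact (h.hasProjectiveDimensionLT_two_or hP.op (Z := .op M) hM hMi.op).symm.imp
      (hP.hasProjectiveDimensionLT_of_op 1 hM) (hP.hasInjectiveDimensionLT_of_op 1 hM)

end Quotient

theorem proposition3p2 {K A : Type u} [CommRing K] [Ring A] [Algebra K A]
    (hA : IsBasicConnectedArtinAlgebra K A)
    (C : Set (ModuleCat.{u} Aᵐᵒᵖ)) (hC : IsARComponent C)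
    (hsemi : IsSemiRegular C) (hext : ¬ HasExternalShortPath C) :
    IsQuasiTilted K (A ⧸ annihilatorOf C) := by
  have := hA.isArtinianRing
  have := hA.finite
  have hmk := Ideal.Quotient.mk_surjective (I := annihilatorOf C)
  have hB : Module.Finite K (A ⧸ annihilatorOf C) :=
    Module.Finite.of_surjective (Ideal.Quotient.mkₐ K (annihilatorOf C)).toLinearMap hmk
  have : Module.Finite K Aᵐᵒᵖ := Module.Finite.equiv (MulOpposite.opLinearEquiv K)
  have : Module.Finite K (A ⧸ annihilatorOf C)ᵐᵒᵖ :=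
    Module.Finite.equiv (MulOpposite.opLinearEquiv K)
  let q : Aᵐᵒᵖ →+* (A ⧸ annihilatorOf C)ᵐᵒᵖ := (Ideal.Quotient.mk (annihilatorOf C)).op
  have hq : Function.Surjective q := fun b => by
    obtain ⟨a, ha⟩ := hmk b.unop
    exact ⟨.op a, congrArg MulOpposite.op ha⟩
  have hker : ∀ r, q r = 0 ↔ ∀ X ∈ C, ∀ x : X, r • x = 0 := fun r => by
    change MulOpposite.op (Ideal.Quotient.mk (annihilatorOf C) r.unop) = 0 ↔ _
    rw [MulOpposite.op_eq_zero_iff, Ideal.Quotient.eq_zero_iff_mem]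
    rfl
  obtain ⟨h1, h2⟩ := homologicalDimensions_of_isARComponent K hq hker hC hsemi hext
  exact ⟨⟨hA.isArtinianRing, hB, hA.basic.of_surjective _ hmk,
    (isConnectedRing_of_isARComponent hq hker hC).of_mulOpposite⟩, h1, fun M hM =>
      have hM' := isFGIndecomposable_iff.1 hM
      h2 M hM'.1 hM'.2⟩
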